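/- Let $\mathbb{C}_+=\{s:\operatorname{Re}s>0\}$. A time-delay system is a function $R(s)=\sum_{i=1}^{n}R_i(s)e^{-h_is}$, $n\ge 1$, where the $R_i$ are nonzero rational functions with real coefficients, proper and stable (no poles in $\operatorname{Re}s\ge 0$), written $R_i=r_i/d$ over a common denominator $d$ whose zeros all have negative real part, and $0\le h_1<\dots<h_n$. Its conjugate is the time-delay system $\bar R(s)=e^{-h_ns}R(-s)M_C(s)$ with $M_C(s)=d(-s)/d(s)$. $R$ is an $F$-system if it has finitely many zeros in $\mathbb{C}_+$, and an $I$-system if $\bar R$ is an $F$-system. For an $F$-system $R$ put $M_R(s)=\prod_z\left(\frac{s-z}{s+\bar z}\right)^{\mu(z)}$, the product over the zeros $z\in\mathbb{C}_+$ of $R$ with multiplicities $\mu(z)$. A function $m$ holomorphic on $\mathbb{C}_+$ is inner if $|m|\le 1$ and $\lim_{\sigma\to0+}|m(\sigma+i\omega)|=1$ for almost every $\omega\in\mathbb{R}$. It is finite dimensional if it is a rational function with real coefficients and without poles in $\operatorname{Re}s\ge 0$. A function $f$ holomorphic on $\mathbb{C}_+$ is outer if it has no zeros there and $\log|f(\sigma+iy)|=\frac1\pi\int_{\mathbb{R}}\frac{\sigma}{\sigma^2+(y-\omega)^2}k(\omega)\,d\omega$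 for some $k:\mathbb{R}\to\mathbb{R}$ with $\int_{\mathbb{R}}\frac{|k(\omega)|}{1+\omega^2}\,d\omega<\infty$. Let $R(s)=\sum_{i=1}^nR_i(s)e^{-h_is}$ and $T(s)=\sum_{j=1}^mT_j(s)e^{-\tau_js}$ be time-delay systems and let $P=R/T$. The identities below hold on $\mathbb{C}_+$, wherever no denominator vanishes. i) (IF plant) Let $R$ be an $I$-system and $T$ an $F$-system. Then $P$ has finitely many poles in $\mathbb{C}_+$. If $h_1\ge\tau_1$, then $P=\hat m_n\hat N_o/\hat m_d$ with $\hat m_n$ inner (possibly infinite dimensional), $\hat m_d$ inner and finite dimensional, and $\hat N_o$ outer, where $$\hat m_n=e^{-(h_1-\tau_1)s}M_{\bar R}\frac{e^{h_1s}R}{\bar R},\qquad \hat m_d=M_T,\qquad \hat N_o=\frac{\bar R}{M_{\bar R}}\,\frac{M_T}{e^{\tau_1s}T}.$$ ii) (FI plant) Let $R$ be an $F$-system and $T$ an $I$-system. Then $P$ has finitely many zeros in $\mathbb{C}_+$. If $h_1=\tau_1$, then $P=\tilde m_d\tilde N_o/\tilde m_n$ with $\tilde m_n$ inner (possibly infinite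 dimensional), $\tilde m_d$ inner and finite dimensional, and $\tilde N_o$ outer, where $$\tilde m_n=M_{\bar T}\frac{e^{\tau_1s}T}{\bar T},\qquad \tilde m_d=M_R,\qquad \tilde N_o=\frac{e^{h_1s}R}{M_R}\,\frac{M_{\bar T}}{\bar T}.$$ iii) (FF plant) Let $R$ and $T$ be $F$-systems. Then $P$ has finitely many zeros and finitely many poles in $\mathbb{C}_+$. If $h_1\ge\tau_1$, then $P=\hat m_n\hat N_o/\hat m_d$ with $\hat m_n$ inner (finite dimensional if $h_1=\tau_1$), $\hat m_d$ inner and finite dimensional, and $\hat N_o$ outer, where $$\hat m_n=e^{-(h_1-\tau_1)s}M_R,\qquad \hat m_d=M_T,\qquad \hat N_o=\frac{e^{h_1s}R}{M_R}\,\frac{M_T}{e^{\tau_1s}T}.$$ In each case, if $P$ is bounded on the imaginary axis, then the outer factor $\hat N_o$ (respectively $\tilde N_o$) is bounded on $\mathbb{C}_+$, that is, it belongs to $H^\infty$. -/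

import Mathlib

open MeasureTheory Filter Topology Polynomial
open scoped ComplexConjugate

noncomputable section

/-- A time-delay system `R(s) = ∑ Rᵢ(s) e^{-hᵢ s}` with finitely many (at least one) terms, indexed
from `0` to `n`.  The coefficients `Rᵢ = num i / den` are nonzero real rational functions, proper and
stable, written over a common denominator (which any finite family of stable rational functions
has); the delays satisfy `0 ≤ h₀ < h₁ < ⋯ < hₙ`. -/
structure DelaySystem where
  n : ℕ
  num : Fin (n + 1) → ℝ[X]
  den : ℝ[X]
  delay : Fin (n + 1) → ℝ
  num_ne_zero : ∀ i, num i ≠ 0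
  proper : ∀ i, (num i).natDegree ≤ den.natDegree
  stable : ∀ z : ℂ, aeval z den = 0 → z.re < 0
  delay_nonneg : 0 ≤ delay 0
  delay_strictMono : StrictMono delay

namespace DelaySystem

/-- The transfer function `s ↦ ∑ Rᵢ(s) e^{-hᵢ s}`. -/
def tf (R : DelaySystem) (s : ℂ) : ℂ :=
  ∑ i, aeval s (R.num i) / aeval s R.den * Complex.exp (-(R.delay i : ℂ) * s)

/-- The smallest delay. -/
def firstDelay (R : DelaySystem) : ℝ := R.delay 0

/-- The largest delay. -/
def lastDelay (R : DelaySystem) : ℝ := R.delay (Fin.last R.n)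

/-- The system without its input delay: `e^{h s} R(s)`, with `h` the smallest delay of `R`. -/
def advanced (R : DelaySystem) (s : ℂ) : ℂ := Complex.exp ((R.firstDelay : ℂ) * s) * R.tf s

/-- The all-pass factor `M_C(s) = den(-s) / den(s)`. -/
def allPass (R : DelaySystem) (s : ℂ) : ℂ := aeval (-s) R.den / aeval s R.den

/-- The conjugate system `e^{-h s} R(-s) M_C(s)`, with `h` the largest delay of `R`, after the
cancellation of the common factor `den(-s)`; see `conjugate_tf`. -/
def conjugate (R : DelaySystem) : DelaySystem where
  n := R.n
  num i := (R.num (Fin.rev i)).comp (-X)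
  den := R.den
  delay i := R.lastDelay - R.delay (Fin.rev i)
  num_ne_zero i h := by
    apply R.num_ne_zero (Fin.rev i)
    have h2 := congrArg (fun p : ℝ[X] => p.comp (-X)) h
    simpa [Polynomial.comp_assoc] using h2
  proper i := by
    rw [Polynomial.natDegree_comp]
    simpa using R.proper (Fin.rev i)
  stable := R.stable
  delay_nonneg := sub_nonneg.2 (R.delay_strictMono.monotone (Fin.le_last _))
  delay_strictMono i j hij :=
    sub_lt_sub_left (R.delay_strictMono (Fin.rev_lt_rev.2 hij)) _

theorem conjugate_tf (R : DelaySystem) (s : ℂ) (hs : aeval (-s) R.den ≠ 0) :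
    R.conjugate.tf s = Complex.exp (-(R.lastDelay : ℂ) * s) * R.tf (-s) * R.allPass s := by
  have key : ∀ p : ℝ[X], aeval s (p.comp (-X)) = aeval (-s) p := by
    intro p; rw [Polynomial.aeval_comp]; simp
  unfold tf allPass
  rw [Finset.mul_sum, Finset.sum_mul]
  change ∑ i : Fin (R.n + 1), aeval s ((R.num (Fin.rev i)).comp (-X)) / aeval s R.den *
    Complex.exp (-((R.lastDelay - R.delay (Fin.rev i) : ℝ) : ℂ) * s) = _
  refine Fintype.sum_equiv Fin.revPerm _ _ fun i => ?_
  have he : Complex.exp (-((R.lastDelay - R.delay (Fin.rev i) : ℝ) : ℂ) * s) =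
      Complex.exp (-(R.lastDelay : ℂ) * s) *
        Complex.exp (-(R.delay (Fin.rev i) : ℂ) * -s) := by
    rw [← Complex.exp_add]; congr 1; push_cast; ring
  rw [key, he, Fin.revPerm_apply]
  by_cases hd : aeval s R.den = 0
  · simp [hd]
  · field_simp

end DelaySystem

/-- The zeros of `f` in the open right half-plane. -/
def unstableZeros (f : ℂ → ℂ) : Set ℂ := {s | 0 < s.re ∧ f s = 0}

namespace DelaySystem

/-- An `F`-system: finitely many unstable zeros. -/
def IsFSystem (R : DelaySystem) : Prop := (unstableZeros R.tf).Finite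

/-- An `I`-system: the conjugate has finitely many unstable zeros. -/
def IsISystem (R : DelaySystem) : Prop := R.conjugate.IsFSystem

/-- For an `F`-system `R`, the inner function `M_R` whose zeros are the unstable zeros of `R`,
counted with multiplicity. -/
def innerPart (R : DelaySystem) (s : ℂ) : ℂ :=
  ∏ᶠ (z : ℂ) (_ : z ∈ unstableZeros R.tf),
    ((s - z) / (s + conj z)) ^ analyticOrderNatAt R.tf z

end DelaySystem

/-- Inner functions of the right half-plane. -/
structure IsInner (m : ℂ → ℂ) : Prop where
  holomorphic : DifferentiableOn ℂ m {s | 0 < s.re}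
  norm_le_one : ∀ s : ℂ, 0 < s.re → ‖m s‖ ≤ 1
  boundary : ∀ᵐ ω : ℝ, Tendsto (fun σ : ℝ => ‖m (σ + ω * Complex.I)‖) (𝓝[>] 0) (𝓝 1)

/-- Outer functions of the right half-plane: holomorphic functions without zeros whose `log |f|` is
the Poisson integral of a function `k` on the imaginary axis with `∫ |k(ω)| / (1 + ω²) dω < ∞`
(then `k(ω) = log |f(iω)|` almost everywhere). -/
structure IsOuter (f : ℂ → ℂ) : Prop where
  holomorphic : DifferentiableOn ℂ f {s | 0 < s.re}
  ne_zero : ∀ s : ℂ, 0 < s.re → f s ≠ 0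
  poisson : ∃ k : ℝ → ℝ, Integrable (fun ω : ℝ => k ω / (1 + ω ^ 2)) ∧
    ∀ s : ℂ, 0 < s.re →
      Real.log ‖f s‖ = (1 / Real.pi) * ∫ ω : ℝ, s.re / (s.re ^ 2 + (s.im - ω) ^ 2) * k ω

/-- Finite-dimensional stable systems: real rational functions without poles in the closed right
half-plane. -/
def IsFiniteDimensional (m : ℂ → ℂ) : Prop :=
  ∃ p q : ℝ[X], (∀ s : ℂ, 0 ≤ s.re → aeval s q ≠ 0) ∧
    ∀ s : ℂ, 0 < s.re → m s = aeval s p / aeval s q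

/-- The plant `P = R / T`. -/
def plant (R T : DelaySystem) (s : ℂ) : ℂ := R.tf s / T.tf s

/-- The zeros of the meromorphic function `P = R / T` in the open right half-plane. -/
def plantUnstableZeros (R T : DelaySystem) : Set ℂ :=
  {s | 0 < s.re ∧ 0 < meromorphicOrderAt (plant R T) s}

/-- The poles of the meromorphic function `P = R / T` in the open right half-plane. -/
def plantUnstablePoles (R T : DelaySystem) : Set ℂ :=
  {s | 0 < s.re ∧ meromorphicOrderAt (plant R T) s < 0}

/-- The outer factor of a plant: outer, and in `H^∞` as soon as the plant is bounded on the
imaginary axis. -/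
def IsOuterFactor (R T : DelaySystem) (No : ℂ → ℂ) : Prop :=
  IsOuter No ∧ ((∃ C : ℝ, ∀ ω : ℝ, ‖plant R T (ω * Complex.I)‖ ≤ C) →
    ∃ C : ℝ, ∀ s : ℂ, 0 < s.re → ‖No s‖ ≤ C)

/-- `P = m_n N_o / m_d` with `m_n` inner, `m_d` finite-dimensional inner, `N_o` outer. -/
structure IsFactorizationOne (R T : DelaySystem) (mn md No : ℂ → ℂ) : Prop where
  inner_mn : IsInner mn
  inner_md : IsInner md
  finite_md : IsFiniteDimensional md
  outer_No : IsOuterFactor R T No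
  eq : ∀ s : ℂ, 0 < s.re → T.tf s ≠ 0 → md s ≠ 0 ∧ plant R T s = mn s * No s / md s

/-- `P = m_d N_o / m_n` with `m_n` inner, `m_d` finite-dimensional inner, `N_o` outer. -/
structure IsFactorizationTwo (R T : DelaySystem) (mn md No : ℂ → ℂ) : Prop where
  inner_mn : IsInner mn
  inner_md : IsInner md
  finite_md : IsFiniteDimensional md
  outer_No : IsOuterFactor R T No
  eq : ∀ s : ℂ, 0 < s.re → T.tf s ≠ 0 → mn s ≠ 0 ∧ plant R T s = md s * No s / mn s

end

/-!
# Inner-outer factorizations of plants with delays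

Write `f_R(s) = e^{h s} R(s)`, with `h` the smallest delay of `R`.  It is bounded on the right
half-plane and analytic across the imaginary axis, since the coefficients are proper and their poles
have negative real part.  On a horizontal ray the first term dominates the others, so that `f_R`
decays at most polynomially there.

If `R` is an `F`-system, then `f_R = M_R g_R` with `M_R` a finite Blaschke product and `g_R` bounded,
zero-free and analytic across the imaginary axis.  Such a function has no Blaschke factor, and a
singular inner factor could only sit at infinity, as `e^{-as}` with `a > 0`, which the slow decay on
horizontal rays excludes; so `g_R` is outer.  This is `IsRegularOuter.poisson`.  Its proof compares
`log |g_R|` on circles in the half-plane that degenerate to the imaginary axis: Jensen's inequality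
and Fatou's lemma give `log |g_R| ≤` Poisson integral of the boundary values
(`log_norm_le_poisson`), and for the converse the only possible loss of mass in the limit, the one at
infinity, is bounded by `-log |g_R(τ)| / τ` for large `τ`
(`integral_le_log_norm_one_of_norm_le_one`).  On compact parts of the axis no mass is lost, since
near a boundary zero the values on the circles dominate a multiple of the boundary values
(`exists_mul_norm_le_approachingCircle`).

Hence quotients of the functions `g_R` are outer, and they are bounded in the half-plane if they are
bounded on the axis, because the bound passes through the Poisson integral
(`IsRegularOuter.bounded_div`).  The coefficients being real, `R` and its conjugate have the same
modulus on the imaginary axis.  If `R` is an `I`-system with conjugate `M g`, then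
`log |f_R| ≤` Poisson integral of `log |g|`, which is `log |g|`, so `f_R / g` is inner even though
`f_R` may have infinitely many zeros (`IsRegularOuter.isInner_div`).  The three factorizations are
obtained by substituting `f_R = M_R g_R`, respectively `f_R = (f_R / g) g`, into `P = R / T`.
-/

/-! ### Averages over the unit circle as integrals over the imaginary axis -/

lemma one_add_mul_I_ne_zero (x : ℝ) : (1 + x * Complex.I : ℂ) ≠ 0 := by
  intro h
  simpa using congrArg Complex.re h

lemma circleMap_neg_two_mul_arctan (ω : ℝ) :
    circleMap 0 1 (-2 * Real.arctan ω) = (1 - ω * Complex.I) / (1 + ω * Complex.I) := by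
  have hpos : (0 : ℝ) < 1 + ω ^ 2 := by positivity
  have hsq : ((√(1 + ω ^ 2) : ℝ) : ℂ) ^ 2 = 1 + (ω : ℂ) ^ 2 := by
    rw [← Complex.ofReal_pow, Real.sq_sqrt hpos.le]; push_cast; ring
  have hs0 : ((√(1 + ω ^ 2) : ℝ) : ℂ) ≠ 0 := by
    exact_mod_cast (Real.sqrt_pos.2 hpos).ne'
  have h1 : Complex.exp (((-Real.arctan ω : ℝ) : ℂ) * Complex.I) =
      (1 - ω * Complex.I) / (√(1 + ω ^ 2) : ℝ) := by
    rw [Complex.exp_mul_I, ← Complex.ofReal_cos, ← Complex.ofReal_sin, Real.cos_neg, Real.sin_neg,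
      Real.cos_arctan, Real.sin_arctan]
    push_cast
    field_simp
    ring
  have h2 : circleMap 0 1 (-2 * Real.arctan ω) =
      Complex.exp (((-Real.arctan ω : ℝ) : ℂ) * Complex.I) ^ 2 := by
    rw [circleMap, ← Complex.exp_nat_mul]
    push_cast
    simp only [zero_add, one_mul]
    congr 1
    ring
  rw [h2, h1, div_pow, hsq, div_eq_div_iff _ (one_add_mul_I_ne_zero ω)]
  · linear_combination (-(ω : ℂ) ^ 2 + (ω : ℂ) ^ 3 * Complex.I) * Complex.I_sq
  · rw [← hsq]; exact pow_ne_zero _ hs0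

lemma image_neg_two_mul_arctan :
    (fun ω : ℝ => -2 * Real.arctan ω) '' Set.univ = Set.Ioo (-Real.pi) Real.pi := by
  ext θ
  simp only [Set.image_univ, Set.mem_range, Set.mem_Ioo]
  constructor
  · rintro ⟨ω, rfl⟩
    have h1 := Real.arctan_lt_pi_div_two ω
    have h2 := Real.neg_pi_div_two_lt_arctan ω
    constructor <;> linarith
  · rintro ⟨h1, h2⟩
    refine ⟨Real.tan (-θ / 2), ?_⟩
    rw [Real.arctan_tan] <;> linarith

lemma hasDerivAt_neg_two_mul_arctan (ω : ℝ) :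
    HasDerivAt (fun ω : ℝ => -2 * Real.arctan ω) (-2 * (1 / (1 + ω ^ 2))) ω :=
  (Real.hasDerivAt_arctan ω).const_mul _

lemma injective_neg_two_mul_arctan : Function.Injective fun ω : ℝ => -2 * Real.arctan ω := by
  intro x y h
  exact Real.arctan_injective (mul_left_cancel₀ (by norm_num : (-2 : ℝ) ≠ 0) h)

/-- The substitution `θ = -2 arctan ω` turns the mean over the unit circle into the mean over the
line against the Cauchy density `1 / (π (1 + ω²))`. -/
theorem circleAverage_eq_integral_cauchy (F : ℂ → ℝ) :
    Real.circleAverage F 0 1 = Real.pi⁻¹ *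
      ∫ ω : ℝ, (1 + ω ^ 2)⁻¹ * F ((1 - ω * Complex.I) / (1 + ω * Complex.I)) := by
  have h1 := integral_image_eq_integral_abs_deriv_smul (F := ℝ) MeasurableSet.univ
    (fun x _ => (hasDerivAt_neg_two_mul_arctan x).hasDerivWithinAt)
    injective_neg_two_mul_arctan.injOn (fun θ => F (circleMap 0 1 θ))
  rw [image_neg_two_mul_arctan, setIntegral_univ] at h1
  have h2 : ∫ θ in (0 : ℝ)..2 * Real.pi, F (circleMap 0 1 θ) =
      ∫ θ in Set.Ioo (-Real.pi) Real.pi, F (circleMap 0 1 θ) := by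
    have hp : Function.Periodic (fun θ => F (circleMap 0 1 θ)) (2 * Real.pi) := fun θ => by
      simp [periodic_circleMap 0 1 θ]
    have := hp.intervalIntegral_add_eq 0 (-Real.pi)
    rw [zero_add, show -Real.pi + 2 * Real.pi = Real.pi by ring] at this
    rw [this, intervalIntegral.integral_of_le (by linarith [Real.pi_pos]),
      integral_Ioc_eq_integral_Ioo]
  rw [Real.circleAverage_def, h2, h1, smul_eq_mul, mul_inv, mul_comm (2 : ℝ)⁻¹, mul_assoc,
    ← integral_const_mul]
  congr 2
  ext ω
  have hpos : (0 : ℝ) < 1 + ω ^ 2 := by positivity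
  rw [circleMap_neg_two_mul_arctan, smul_eq_mul, abs_mul, abs_of_pos (one_div_pos.2 hpos)]
  norm_num
  ring

theorem CircleIntegrable.integrable_cauchy {F : ℂ → ℝ} (hF : CircleIntegrable F 0 1) :
    Integrable fun ω : ℝ =>
      (1 + ω ^ 2)⁻¹ * F ((1 - ω * Complex.I) / (1 + ω * Complex.I)) := by
  have h1 := integrableOn_image_iff_integrableOn_abs_deriv_smul (F := ℝ) MeasurableSet.univ
    (fun x _ => (hasDerivAt_neg_two_mul_arctan x).hasDerivWithinAt)
    injective_neg_two_mul_arctan.injOn (fun θ => F (circleMap 0 1 θ))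
  rw [image_neg_two_mul_arctan, integrableOn_univ] at h1
  have hp : Function.Periodic (fun θ => F (circleMap 0 1 θ)) (2 * Real.pi) := fun θ => by
    simp [periodic_circleMap 0 1 θ]
  have h2 : IntervalIntegrable (fun θ => F (circleMap 0 1 θ)) volume (-Real.pi) Real.pi :=
    hp.intervalIntegrable₀ (by positivity) hF _ _
  rw [intervalIntegrable_iff_integrableOn_Ioo_of_le (by linarith [Real.pi_pos])] at h2
  refine ((h1.1 h2).const_mul (2 : ℝ)⁻¹).congr (.of_forall fun ω => ?_)
  have hpos : (0 : ℝ) < 1 + ω ^ 2 := by positivity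
  simp only []
  rw [circleMap_neg_two_mul_arctan, smul_eq_mul, abs_mul, abs_of_pos (one_div_pos.2 hpos)]
  norm_num
  ring

/-! ### The mean value and Poisson formulas on circles exhausting the right half-plane -/

/-- For `0 < ε < 1` the image of `ω` runs over the circle `|(s - 1) / (s + 1)| = (1 - ε) / (1 + ε)`,
which degenerates to the imaginary axis (parametrized by `ω ↦ iω`) as `ε → 0`. -/
noncomputable def approachingCircle (ε ω : ℝ) : ℂ :=
  (ε + ω * Complex.I) / (1 + (ε * ω : ℝ) * Complex.I)

lemma approachingCircle_re (ε ω : ℝ) :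
    (approachingCircle ε ω).re = ε * (1 + ω ^ 2) / (1 + (ε * ω) ^ 2) := by
  rw [approachingCircle, Complex.div_re, Complex.normSq_apply]
  simp
  ring

lemma approachingCircle_re_pos {ε : ℝ} (hε : 0 < ε) (ω : ℝ) : 0 < (approachingCircle ε ω).re := by
  rw [approachingCircle_re]; positivity

lemma one_add_ne_zero_of_norm_lt_one {w : ℂ} (hw : ‖w‖ < 1) : 1 + w ≠ 0 := by
  intro h
  have : w = -1 := by linear_combination h
  simp [this] at hw

lemma cayley_re_pos {w : ℂ} (hw : ‖w‖ < 1) : 0 < ((1 - w) / (1 + w)).re := by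
  have h0 : 0 < Complex.normSq (1 + w) := Complex.normSq_pos.2 (one_add_ne_zero_of_norm_lt_one hw)
  have h1 : Complex.normSq w < 1 := by
    rw [Complex.normSq_eq_norm_sq]; nlinarith [norm_nonneg w]
  rw [Complex.div_re, ← add_div]
  refine div_pos ?_ h0
  rw [Complex.normSq_apply] at h1
  simp
  nlinarith

lemma cayley_mul_circle {ε : ℝ} (hε : 0 < ε) (ω : ℝ) :
    (1 - ((1 - ε) / (1 + ε) : ℝ) * ((1 - ω * Complex.I) / (1 + ω * Complex.I))) /
      (1 + ((1 - ε) / (1 + ε) : ℝ) * ((1 - ω * Complex.I) / (1 + ω * Complex.I))) =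
      approachingCircle ε ω := by
  have h1 := one_add_mul_I_ne_zero ω
  have h2 := one_add_mul_I_ne_zero (ε * ω)
  have h3 : (1 + ε : ℂ) ≠ 0 := by exact_mod_cast (by positivity : (1 + ε : ℝ) ≠ 0)
  rw [approachingCircle]
  push_cast at h2 ⊢
  rw [show (1 - (1 - (ε : ℂ)) / (1 + ε) * ((1 - ω * Complex.I) / (1 + ω * Complex.I))) =
      2 * (ε + ω * Complex.I) / ((1 + ε) * (1 + ω * Complex.I)) by field_simp; ring,
    show (1 + (1 - (ε : ℂ)) / (1 + ε) * ((1 - ω * Complex.I) / (1 + ω * Complex.I))) =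
      2 * (1 + ε * ω * Complex.I) / ((1 + ε) * (1 + ω * Complex.I)) by field_simp; ring]
  field_simp

lemma norm_ratio_mul_lt_one {ε : ℝ} (hε : 0 < ε) (hε1 : ε < 1) {w : ℂ} (hw : ‖w‖ ≤ 1) :
    ‖((1 - ε) / (1 + ε) : ℝ) * w‖ < 1 := by
  have h : 0 ≤ (1 - ε) / (1 + ε) := div_nonneg (by linarith) (by linarith)
  have h' : (1 - ε) / (1 + ε) < 1 := by rw [div_lt_one (by linarith)]; linarith
  rw [norm_mul, Complex.norm_real, Real.norm_of_nonneg h]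
  nlinarith [norm_nonneg w]

lemma analyticOnNhd_comp_cayley {f : ℂ → ℂ} (hf : AnalyticOnNhd ℂ f {s | 0 < s.re}) {ε : ℝ}
    (hε : 0 < ε) (hε1 : ε < 1) :
    AnalyticOnNhd ℂ (fun w => f ((1 - ((1 - ε) / (1 + ε) : ℝ) * w) /
      (1 + ((1 - ε) / (1 + ε) : ℝ) * w))) (Metric.closedBall 0 1) := by
  intro w hw
  have hn := norm_ratio_mul_lt_one hε hε1 (by simpa using hw)
  refine AnalyticAt.fun_comp (g := f) (hf _ (cayley_re_pos hn)) ?_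
  exact ((analyticAt_const).sub (analyticAt_const.mul analyticAt_id)).div
    ((analyticAt_const).add (analyticAt_const.mul analyticAt_id))
    (one_add_ne_zero_of_norm_lt_one hn)

lemma norm_circle_point (ω : ℝ) : ‖(1 - ω * Complex.I) / (1 + ω * Complex.I)‖ = 1 := by
  rw [← circleMap_neg_two_mul_arctan]; simp

lemma poissonKernel_cayley {τ : ℝ} (hτ : 0 < τ) (ω : ℝ) :
    poissonKernel 0 ((1 - τ) / (1 + τ) : ℝ) ((1 - ω * Complex.I) / (1 + ω * Complex.I)) =
      τ * (1 + ω ^ 2) / (τ ^ 2 + ω ^ 2) := by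
  have h1 := one_add_mul_I_ne_zero ω
  have h3 : (1 + τ : ℂ) ≠ 0 := by exact_mod_cast (by positivity : (1 + τ : ℝ) ≠ 0)
  have hn : ∀ a b : ℝ, ‖(a + b * Complex.I : ℂ)‖ ^ 2 = a ^ 2 + b ^ 2 := fun a b => by
    rw [← Complex.normSq_eq_norm_sq, Complex.normSq_add_mul_I]
  rw [poissonKernel_def, sub_zero, sub_zero, norm_circle_point, Complex.norm_real,
    Real.norm_eq_abs, sq_abs]
  have h4 : (1 - ω * Complex.I) / (1 + ω * Complex.I) - ((1 - τ) / (1 + τ) : ℝ) =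
      2 * (τ + (-ω : ℝ) * Complex.I) / ((1 + τ : ℝ) * ((1 : ℝ) + ω * Complex.I)) := by
    push_cast
    field_simp
    ring
  rw [h4, norm_div, norm_mul, norm_mul, div_pow, div_pow, mul_pow, mul_pow, hn, hn, Complex.norm_real,
    Real.norm_eq_abs, sq_abs]
  have : (0 : ℝ) < 1 + τ := by linarith
  have : (0 : ℝ) < τ ^ 2 + ω ^ 2 := by positivity
  norm_num
  field_simp
  ring

/-- Poisson's formula for `log |g|` on the approaching circles, at a point of the real axis. -/
theorem poisson_approachingCircle {g : ℂ → ℂ} (hg : AnalyticOnNhd ℂ g {s | 0 < s.re})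
    (hg0 : ∀ s : ℂ, 0 < s.re → g s ≠ 0) {ε τ : ℝ} (hε : 0 < ε) (hε1 : ε < 1) (hτ : 0 < τ) :
    (Integrable fun ω : ℝ => τ / (τ ^ 2 + ω ^ 2) * Real.log ‖g (approachingCircle ε ω)‖) ∧
    Real.log ‖g ((τ + ε) / (1 + ε * τ) : ℝ)‖ =
      Real.pi⁻¹ * ∫ ω : ℝ, τ / (τ ^ 2 + ω ^ 2) * Real.log ‖g (approachingCircle ε ω)‖ := by
  set G : ℂ → ℂ := fun w => g ((1 - ((1 - ε) / (1 + ε) : ℝ) * w) /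
      (1 + ((1 - ε) / (1 + ε) : ℝ) * w)) with hG
  have hGa : AnalyticOnNhd ℂ G (Metric.closedBall 0 1) := analyticOnNhd_comp_cayley hg hε hε1
  have hG0 : ∀ w ∈ Metric.closedBall (0 : ℂ) 1, G w ≠ 0 := fun w hw =>
    hg0 _ (cayley_re_pos (norm_ratio_mul_lt_one hε hε1 (by simpa using hw)))
  have hpt : (((1 - τ) / (1 + τ) : ℝ) : ℂ) ∈ Metric.ball (0 : ℂ) 1 := by
    rw [mem_ball_zero_iff, Complex.norm_real, Real.norm_eq_abs, abs_lt, lt_div_iff₀ (by linarith),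
      div_lt_one (by linarith)]
    constructor <;> linarith
  have hker : ∀ ω : ℝ, (1 + ω ^ 2)⁻¹ *
      ((poissonKernel 0 ((1 - τ) / (1 + τ) : ℝ) • fun w => Real.log ‖G w‖)
        ((1 - ω * Complex.I) / (1 + ω * Complex.I))) =
      τ / (τ ^ 2 + ω ^ 2) * Real.log ‖g (approachingCircle ε ω)‖ := by
    intro ω
    rw [Pi.smul_apply', smul_eq_mul, poissonKernel_cayley hτ, hG]
    simp only []
    rw [cayley_mul_circle hε]
    have : (0 : ℝ) < 1 + ω ^ 2 := by positivity
    field_simp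
  have hcont : ContinuousOn (poissonKernel 0 ((1 - τ) / (1 + τ) : ℝ) • fun w => Real.log ‖G w‖)
      (Metric.sphere 0 1) := by
    rw [poissonKernel_eq_re_herglotzRieszKernel]
    refine ContinuousOn.smul ?_ ?_
    · have := continuousOn_herglotzRieszKernel_sphere hpt
      rw [abs_one] at this
      exact Complex.continuous_re.comp_continuousOn this
    · exact ((hGa.continuousOn.mono Metric.sphere_subset_closedBall).norm).log fun w hw =>
        norm_ne_zero_iff.2 (hG0 w (Metric.sphere_subset_closedBall hw))
  refine ⟨(hcont.circleIntegrable zero_le_one).integrable_cauchy.congr (.of_forall hker), ?_⟩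
  have hP := InnerProductSpace.HarmonicOnNhd.circleAverage_poissonKernel_smul
    (fun w hw => (hGa w hw).harmonicAt_log_norm (hG0 w hw)) hpt
  rw [circleAverage_eq_integral_cauchy] at hP
  simp only [hker] at hP
  rw [hP, hG]
  congr 3
  have h1 : (1 + ε : ℝ) ≠ 0 := by positivity
  have h2 : (1 + τ : ℝ) ≠ 0 := by positivity
  have h3 : (1 + ε * τ : ℝ) ≠ 0 := by positivity
  norm_cast
  rw [show 1 - (1 - ε) / (1 + ε) * ((1 - τ) / (1 + τ)) =
      2 * (τ + ε) / ((1 + ε) * (1 + τ)) by field_simp; ring,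
    show 1 + (1 - ε) / (1 + ε) * ((1 - τ) / (1 + τ)) =
      2 * (1 + ε * τ) / ((1 + ε) * (1 + τ)) by field_simp; ring]
  field_simp

/-- The inequality in Jensen's formula: `log |f|` is dominated by its mean on the approaching
circles. -/
theorem log_norm_le_mean_approachingCircle {f : ℂ → ℂ} (hf : AnalyticOnNhd ℂ f {s | 0 < s.re})
    (hf1 : f 1 ≠ 0) {ε : ℝ} (hε : 0 < ε) (hε1 : ε < 1) :
    (Integrable fun ω : ℝ => (1 + ω ^ 2)⁻¹ * Real.log ‖f (approachingCircle ε ω)‖) ∧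
    Real.log ‖f 1‖ ≤
      Real.pi⁻¹ * ∫ ω : ℝ, (1 + ω ^ 2)⁻¹ * Real.log ‖f (approachingCircle ε ω)‖ := by
  set G : ℂ → ℂ := fun w => f ((1 - ((1 - ε) / (1 + ε) : ℝ) * w) /
      (1 + ((1 - ε) / (1 + ε) : ℝ) * w)) with hG
  have hGa : AnalyticOnNhd ℂ G (Metric.closedBall 0 |1|) := by
    rw [abs_one]; exact analyticOnNhd_comp_cayley hf hε hε1
  have hker : ∀ ω : ℝ, G ((1 - ω * Complex.I) / (1 + ω * Complex.I)) =
      f (approachingCircle ε ω) := fun ω => by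
    rw [hG]; simp only []; rw [cayley_mul_circle hε]
  have hG1 : G 0 = f 1 := by simp [hG]
  have hci : CircleIntegrable (fun w => Real.log ‖G w‖) 0 1 :=
    MeromorphicOn.circleIntegrable_log_norm
      fun w hw => (hGa w (Metric.sphere_subset_closedBall hw)).meromorphicAt
  have h1 := hci.integrable_cauchy
  have h2 := AnalyticOnNhd.circleAverage_log_norm one_ne_zero hGa (hG1 ▸ hf1)
  rw [circleAverage_eq_integral_cauchy] at h2
  simp only [hker] at h1 h2
  refine ⟨h1, ?_⟩
  rw [h2, hG1]
  refine le_add_of_nonneg_left (finsum_nonneg fun u => ?_)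
  by_cases hu : u ∈ Metric.closedBall (0 : ℂ) |1|
  · refine mul_nonneg ?_ ?_
    · exact_mod_cast MeromorphicOn.AnalyticOnNhd.divisor_nonneg hGa u
    · rw [one_mul]
      rw [abs_one, mem_closedBall_zero_iff] at hu
      rcases eq_or_ne u 0 with rfl | h0
      · simp
      · rw [zero_sub, norm_neg]
        exact Real.log_nonneg (one_le_inv_iff₀.2 ⟨norm_pos_iff.2 h0, hu⟩)
  · rw [Function.locallyFinsuppWithin.apply_eq_zero_of_notMem _ hu]
    simp

/-! ### Boundary limits of `log |f|` -/

lemma isPreconnected_closedRightHalfPlane : IsPreconnected {s : ℂ | 0 ≤ s.re} :=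
  (convex_halfSpace_re_ge 0).isPreconnected

lemma not_eventually_eq_zero {f : ℂ → ℂ} (hf : AnalyticOnNhd ℂ f {s | 0 ≤ s.re})
    (hne : ∃ s : ℂ, 0 ≤ s.re ∧ f s ≠ 0) {z : ℂ} (hz : 0 ≤ z.re) : ¬ ∀ᶠ s in 𝓝 z, f s = 0 := by
  intro h
  obtain ⟨s, hs, hs0⟩ := hne
  exact hs0 (hf.eqOn_zero_of_preconnected_of_eventuallyEq_zero
    isPreconnected_closedRightHalfPlane hz h hs)

lemma ae_ne_zero_mul_I {f : ℂ → ℂ} (hf : AnalyticOnNhd ℂ f {s | 0 ≤ s.re})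
    (hne : ∃ s : ℂ, 0 ≤ s.re ∧ f s ≠ 0) : ∀ᵐ ω : ℝ, f (ω * Complex.I) ≠ 0 := by
  have hmem : {ω : ℝ | f (ω * Complex.I) ≠ 0} ∈ codiscrete ℝ := by
    rw [mem_codiscrete]
    intro ω
    rw [disjoint_principal_right, compl_compl]
    have hz : (0 : ℝ) ≤ ((ω : ℂ) * Complex.I).re := by simp
    have h1 := ((hf _ hz).eventually_eq_zero_or_eventually_ne_zero).resolve_left
      (not_eventually_eq_zero hf hne hz)
    have hc : Tendsto (fun x : ℝ => (x : ℂ) * Complex.I) (𝓝[≠] ω) (𝓝[≠] (ω * Complex.I)) := by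
      refine tendsto_nhdsWithin_iff.2 ⟨?_, ?_⟩
      · exact Continuous.tendsto' (by fun_prop) _ _ rfl |>.mono_left nhdsWithin_le_nhds
      · filter_upwards [self_mem_nhdsWithin] with x hx h
        exact hx (by simpa using h)
    exact hc.eventually h1
  have := ae_restrict_le_codiscreteWithin (μ := (volume : Measure ℝ)) MeasurableSet.univ hmem
  rwa [Measure.restrict_univ] at this

lemma tendsto_approachingCircle (ω : ℝ) :
    Tendsto (fun ε => approachingCircle ε ω) (𝓝 0) (𝓝 (ω * Complex.I)) := by
  have : ContinuousAt (fun ε => approachingCircle ε ω) 0 := by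
    unfold approachingCircle
    refine ContinuousAt.div (by fun_prop) (by fun_prop) ?_
    simp
  simpa [ContinuousAt, approachingCircle] using this

lemma tendsto_norm_approachingCircle {f : ℂ → ℂ} (hf : AnalyticOnNhd ℂ f {s | 0 ≤ s.re}) (ω : ℝ) :
    Tendsto (fun ε => ‖f (approachingCircle ε ω)‖) (𝓝 0) (𝓝 ‖f (ω * Complex.I)‖) :=
  ((hf _ (by simp)).continuousAt.tendsto.comp (tendsto_approachingCircle ω)).norm

lemma tendsto_one_div_add_two : Tendsto (fun n : ℕ => 1 / ((n : ℝ) + 2)) atTop (𝓝 0) := by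
  have := (tendsto_one_div_add_atTop_nhds_zero_nat (𝕜 := ℝ)).comp (tendsto_add_atTop_nat 1)
  refine this.congr fun n => ?_
  simp only [Function.comp_apply]; push_cast; ring

lemma one_div_add_two_pos (n : ℕ) : 0 < 1 / ((n : ℝ) + 2) := by positivity

lemma one_div_add_two_lt_one (n : ℕ) : 1 / ((n : ℝ) + 2) < 1 := by
  rw [div_lt_one (by positivity)]; linarith [(Nat.cast_nonneg n : (0 : ℝ) ≤ n)]

lemma norm_le_of_closed {f : ℂ → ℂ} (hf : AnalyticOnNhd ℂ f {s | 0 ≤ s.re}) {C : ℝ}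
    (hC : ∀ s : ℂ, 0 < s.re → ‖f s‖ ≤ C) (ω : ℝ) : ‖f (ω * Complex.I)‖ ≤ C :=
  le_of_tendsto ((tendsto_norm_approachingCircle hf ω).comp tendsto_one_div_add_two)
    (.of_forall fun n => hC _ (approachingCircle_re_pos (one_div_add_two_pos n) ω))

/-- Fatou's lemma applied to `-log |f| ≥ 0` on the approaching circles. -/
theorem log_norm_one_le_integral_of_norm_le_one {f : ℂ → ℂ}
    (hf : AnalyticOnNhd ℂ f {s | 0 ≤ s.re}) (hf1 : f 1 ≠ 0) (hb : ∀ s : ℂ, 0 < s.re → ‖f s‖ ≤ 1) :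
    (Integrable fun ω : ℝ => (1 + ω ^ 2)⁻¹ * Real.log ‖f (ω * Complex.I)‖) ∧
    Real.log ‖f 1‖ ≤ Real.pi⁻¹ * ∫ ω : ℝ, (1 + ω ^ 2)⁻¹ * Real.log ‖f (ω * Complex.I)‖ := by
  have hne : ∃ s : ℂ, 0 ≤ s.re ∧ f s ≠ 0 := ⟨1, by simp, hf1⟩
  have hf' : AnalyticOnNhd ℂ f {s | 0 < s.re} := hf.mono fun s (hs : 0 < s.re) => hs.le
  set V : ℝ → ℝ := fun ω => -((1 + ω ^ 2)⁻¹ * Real.log ‖f (ω * Complex.I)‖) with hV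
  set Vn : ℕ → ℝ → ℝ := fun n ω =>
    -((1 + ω ^ 2)⁻¹ * Real.log ‖f (approachingCircle (1 / ((n : ℝ) + 2)) ω)‖) with hVn
  have hVn0 : ∀ n ω, 0 ≤ Vn n ω := fun n ω =>
    neg_nonneg.2 (mul_nonpos_of_nonneg_of_nonpos (by positivity)
      (Real.log_nonpos (norm_nonneg _) (hb _ (approachingCircle_re_pos (one_div_add_two_pos n) ω))))
  have hV0 : ∀ ω, 0 ≤ V ω := fun ω =>
    neg_nonneg.2 (mul_nonpos_of_nonneg_of_nonpos (by positivity)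
      (Real.log_nonpos (norm_nonneg _) (norm_le_of_closed hf hb ω)))
  have hJ : ∀ n, Integrable (Vn n) ∧ ∫ ω, Vn n ω ≤ Real.pi * -Real.log ‖f 1‖ := by
    intro n
    obtain ⟨h1, h2⟩ := log_norm_le_mean_approachingCircle hf' hf1 (one_div_add_two_pos n)
      (one_div_add_two_lt_one n)
    refine ⟨h1.neg, ?_⟩
    rw [hVn, integral_neg]
    have := mul_le_mul_of_nonneg_left h2 Real.pi_pos.le
    rw [← mul_assoc, mul_inv_cancel₀ Real.pi_ne_zero, one_mul] at this
    linarith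
  have hlim : ∀ᵐ ω, Tendsto (fun n => Vn n ω) atTop (𝓝 (V ω)) := by
    filter_upwards [ae_ne_zero_mul_I hf hne] with ω hω
    have := ((tendsto_norm_approachingCircle hf ω).comp tendsto_one_div_add_two).log
      (norm_ne_zero_iff.2 hω)
    exact (this.const_mul _).neg
  have hmeas : AEStronglyMeasurable V volume :=
    aestronglyMeasurable_of_tendsto_ae _ (fun n => (hJ n).1.aestronglyMeasurable) hlim
  have hF : ∫⁻ ω, ENNReal.ofReal (V ω) ≤ ENNReal.ofReal (Real.pi * -Real.log ‖f 1‖) := by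
    calc ∫⁻ ω, ENNReal.ofReal (V ω)
        = ∫⁻ ω, liminf (fun n => ENNReal.ofReal (Vn n ω)) atTop := by
          refine lintegral_congr_ae ?_
          filter_upwards [hlim] with ω hω
          exact ((ENNReal.continuous_ofReal.tendsto _).comp hω).liminf_eq.symm
      _ ≤ liminf (fun n => ∫⁻ ω, ENNReal.ofReal (Vn n ω)) atTop :=
          lintegral_liminf_le' fun n => (hJ n).1.aemeasurable.ennreal_ofReal
      _ ≤ ENNReal.ofReal (Real.pi * -Real.log ‖f 1‖) := by
          refine liminf_le_of_le (by isBoundedDefault) fun b hb => ?_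
          obtain ⟨n, hn⟩ := hb.exists
          refine hn.trans ?_
          rw [← ofReal_integral_eq_lintegral_ofReal (hJ n).1 (.of_forall (hVn0 n))]
          exact ENNReal.ofReal_le_ofReal (hJ n).2
  have hint : Integrable V := by
    refine ⟨hmeas, ?_⟩
    rw [hasFiniteIntegral_iff_ofReal (.of_forall hV0)]
    exact hF.trans_lt ENNReal.ofReal_lt_top
  have hle : ∫ ω, V ω ≤ Real.pi * -Real.log ‖f 1‖ := by
    rw [← ofReal_integral_eq_lintegral_ofReal hint (.of_forall hV0)] at hF
    refine (ENNReal.ofReal_le_ofReal_iff (mul_nonneg Real.pi_pos.le (neg_nonneg.2 ?_))).1 hF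
    exact Real.log_nonpos (norm_nonneg _) (hb 1 (by simp))
  have hint' : Integrable fun ω : ℝ => (1 + ω ^ 2)⁻¹ * Real.log ‖f (ω * Complex.I)‖ := by
    simpa [hV] using hint.neg
  refine ⟨hint', ?_⟩
  rw [hV, integral_neg] at hle
  rw [inv_mul_eq_div, le_div_iff₀ Real.pi_pos]
  linarith

/-- Near a compact part of the imaginary axis an analytic function on the approaching circles is
bounded below by a multiple of its boundary value: at a boundary zero `iω₀` both sides are
comparable to powers of the distance to `iω₀` with the same exponent. -/
lemma exists_mul_norm_le_approachingCircle {g : ℂ → ℂ} (hg : AnalyticOnNhd ℂ g {s | 0 ≤ s.re})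
    (hne : ∃ s : ℂ, 0 ≤ s.re ∧ g s ≠ 0) {K : Set ℝ} (hK : IsCompact K) :
    ∃ c : ℝ, 0 < c ∧ ∀ᶠ ε in 𝓝 (0 : ℝ), ∀ ω ∈ K,
      c * ‖g (ω * Complex.I)‖ ≤ ‖g (approachingCircle ε ω)‖ := by
  refine hK.induction_on (p := fun K => ∃ c : ℝ, 0 < c ∧ ∀ᶠ ε in 𝓝 (0 : ℝ), ∀ ω ∈ K,
      c * ‖g (ω * Complex.I)‖ ≤ ‖g (approachingCircle ε ω)‖) ⟨1, one_pos, by simp⟩ ?_ ?_ ?_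
  · rintro s t hst ⟨c, hc, h⟩
    exact ⟨c, hc, h.mono fun ε he ω hω => he ω (hst hω)⟩
  · rintro s t ⟨c, hc, h⟩ ⟨d, hd, h'⟩
    refine ⟨min c d, lt_min hc hd, ?_⟩
    filter_upwards [h, h'] with ε h1 h2 ω hω
    rcases hω with hω | hω
    · exact (mul_le_mul_of_nonneg_right (min_le_left _ _) (norm_nonneg _)).trans (h1 ω hω)
    · exact (mul_le_mul_of_nonneg_right (min_le_right _ _) (norm_nonneg _)).trans (h2 ω hω)
  · intro ω₀ _
    have hz : (0 : ℝ) ≤ ((ω₀ : ℂ) * Complex.I).re := by simp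
    obtain ⟨m, h, hh, hh0, heq⟩ := (hg _ hz).exists_eventuallyEq_pow_smul_nonzero_iff.2
      (not_eventually_eq_zero hg hne hz)
    set q : ℝ := ‖h (ω₀ * Complex.I)‖ with hq
    have hqpos : 0 < q := norm_pos_iff.2 hh0
    have hnear : ∀ᶠ s in 𝓝 ((ω₀ : ℂ) * Complex.I), q / 2 ≤ ‖h s‖ ∧ ‖h s‖ ≤ 2 * q ∧
        g s = (s - ω₀ * Complex.I) ^ m • h s := by
      have hc := hh.continuousAt.norm
      filter_upwards [hc.eventually (lt_mem_nhds (by linarith : q / 2 < q)),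
        hc.eventually (gt_mem_nhds (by linarith : q < 2 * q)), heq] with s h1 h2 h3
      exact ⟨h1.le, h2.le, h3⟩
    have hcont : ContinuousAt (fun p : ℝ × ℝ => approachingCircle p.1 p.2) (0, ω₀) := by
      unfold approachingCircle
      refine ContinuousAt.div (by fun_prop) (by fun_prop) ?_
      simp
    have h0 : approachingCircle 0 ω₀ = ω₀ * Complex.I := by simp [approachingCircle]
    have hev1 : ∀ᶠ p : ℝ × ℝ in 𝓝 0 ×ˢ 𝓝 ω₀, q / 2 ≤ ‖h (approachingCircle p.1 p.2)‖ ∧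
        g (approachingCircle p.1 p.2) =
          (approachingCircle p.1 p.2 - ω₀ * Complex.I) ^ m • h (approachingCircle p.1 p.2) := by
      rw [← nhds_prod_eq]
      rw [ContinuousAt] at hcont
      simp only [h0] at hcont
      exact (hcont.eventually hnear).mono fun p hp => ⟨hp.1, hp.2.2⟩
    have hev2 : ∀ᶠ p : ℝ × ℝ in 𝓝 0 ×ˢ 𝓝 ω₀, ‖(1 + (p.1 * p.2 : ℝ) * Complex.I : ℂ)‖ < 2 := by
      rw [← nhds_prod_eq]
      have : ContinuousAt (fun p : ℝ × ℝ => ‖(1 + (p.1 * p.2 : ℝ) * Complex.I : ℂ)‖) (0, ω₀) := by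
        fun_prop
      exact this.eventually (gt_mem_nhds (by norm_num))
    have hev3 : ∀ᶠ ω : ℝ in 𝓝 ω₀, ‖h (ω * Complex.I)‖ ≤ 2 * q ∧
        g (ω * Complex.I) = (ω * Complex.I - ω₀ * Complex.I) ^ m • h (ω * Complex.I) := by
      have : ContinuousAt (fun ω : ℝ => (ω : ℂ) * Complex.I) ω₀ := by fun_prop
      exact (this.eventually hnear).mono fun p hp => hp.2
    obtain ⟨P, hP, Q, hQ, hPQ⟩ := eventually_prod_iff.1 (hev1.and hev2)
    refine ⟨{ω | Q ω ∧ ‖h (ω * Complex.I)‖ ≤ 2 * q ∧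
        g (ω * Complex.I) = (ω * Complex.I - ω₀ * Complex.I) ^ m • h (ω * Complex.I)},
      mem_nhdsWithin_of_mem_nhds (hQ.and hev3), (2 ^ m * 4)⁻¹, by positivity, ?_⟩
    filter_upwards [hP] with ε hε ω hω
    obtain ⟨⟨h1, h2⟩, h3⟩ := hPQ hε hω.1
    simp only [] at h1 h2 h3
    rw [hω.2.2, h2, norm_smul, norm_smul, norm_pow, norm_pow, ← sub_mul, norm_mul, Complex.norm_I,
      mul_one, ← Complex.ofReal_sub, Complex.norm_real]
    have hd : ‖ω - ω₀‖ / 2 ≤ ‖approachingCircle ε ω - ω₀ * Complex.I‖ := by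
      have hne' := one_add_mul_I_ne_zero (ε * ω)
      have : approachingCircle ε ω - ω₀ * Complex.I =
          ((ε * (1 + ω * ω₀) : ℝ) + (ω - ω₀ : ℝ) * Complex.I) /
            (1 + (ε * ω : ℝ) * Complex.I) := by
        rw [approachingCircle, eq_div_iff hne', sub_mul, div_mul_cancel₀ _ hne']
        push_cast
        linear_combination (-(ω₀ : ℂ) * ε * ω) * Complex.I_sq
      rw [this, norm_div]
      have him : ‖ω - ω₀‖ ≤ ‖((ε * (1 + ω * ω₀) : ℝ) + (ω - ω₀ : ℝ) * Complex.I : ℂ)‖ := by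
        refine le_trans (le_of_eq ?_) (Complex.abs_im_le_norm _)
        simp
      exact div_le_div₀ (norm_nonneg _) him (norm_pos_iff.2 hne') h3.le
    calc (2 ^ m * 4)⁻¹ * (‖ω - ω₀‖ ^ m * ‖h (ω * Complex.I)‖)
        ≤ (2 ^ m * 4)⁻¹ * (‖ω - ω₀‖ ^ m * (2 * q)) := by gcongr; exact hω.2.1
      _ = (‖ω - ω₀‖ / 2) ^ m * (q / 2) := by rw [div_pow]; field_simp; ring
      _ ≤ _ := by gcongr

/-- A bounded zero-free function analytic across the imaginary axis whose decay along the positive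
real axis is subexponential has no inner factor: a singular inner factor could only be a point mass
at infinity, that is `e^{-as}` with `a > 0`.  In the proof the part of the mass of `-log |g|` lying
on the approaching circles beyond `|ω| = τ` is estimated by `-log |g(τ)| / τ`. -/
theorem integral_le_log_norm_one_of_norm_le_one {g : ℂ → ℂ}
    (hg : AnalyticOnNhd ℂ g {s | 0 ≤ s.re}) (hg0 : ∀ s : ℂ, 0 < s.re → g s ≠ 0)
    (hb : ∀ s : ℂ, 0 < s.re → ‖g s‖ ≤ 1)
    (hdecay : ∀ a : ℝ, 0 < a → ∀ᶠ τ : ℝ in atTop, -(a * τ) ≤ Real.log ‖g τ‖) :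
    Real.pi⁻¹ * ∫ ω : ℝ, (1 + ω ^ 2)⁻¹ * Real.log ‖g (ω * Complex.I)‖ ≤ Real.log ‖g 1‖ := by
  have hg1 : g 1 ≠ 0 := hg0 1 (by simp)
  have hne : ∃ s : ℂ, 0 ≤ s.re ∧ g s ≠ 0 := ⟨1, by simp, hg1⟩
  have hg' : AnalyticOnNhd ℂ g {s | 0 < s.re} := hg.mono fun s (hs : 0 < s.re) => hs.le
  have hint := (log_norm_one_le_integral_of_norm_le_one hg hg1 hb).1
  set e : ℕ → ℝ := fun n => 1 / ((n : ℝ) + 2) with he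
  have hlog0 : ∀ n ω, Real.log ‖g (approachingCircle (e n) ω)‖ ≤ 0 := fun n ω =>
    Real.log_nonpos (norm_nonneg _) (hb _ (approachingCircle_re_pos (one_div_add_two_pos n) ω))
  have hlogb : ∀ ω : ℝ, Real.log ‖g (ω * Complex.I)‖ ≤ 0 := fun ω =>
    Real.log_nonpos (norm_nonneg _) (norm_le_of_closed hg hb ω)
  refine le_of_forall_pos_le_add fun a ha => ?_
  -- for `|ω| ≥ τ` the Poisson kernel at `τ` is at least `τ / 2` times the Poisson kernel at `1`
  obtain ⟨τ, hτa, hτ1⟩ := ((hdecay (a / 2) (by positivity)).and (eventually_ge_atTop 1)).exists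
  have hτ0 : 0 < τ := by linarith
  set S : Set ℝ := Set.Icc (-τ) τ with hS
  have hSm : MeasurableSet S := measurableSet_Icc
  -- the estimate of the mean over `S` on each circle
  have hstep : ∀ n, Real.pi⁻¹ * ∫ ω in S, (1 + ω ^ 2)⁻¹ *
      Real.log ‖g (approachingCircle (e n) ω)‖ ≤
      Real.log ‖g 1‖ - 2 / τ * Real.log ‖g ((τ + e n) / (1 + e n * τ) : ℝ)‖ := by
    intro n
    obtain ⟨hi1, h1⟩ := poisson_approachingCircle hg' hg0 (one_div_add_two_pos n)
      (one_div_add_two_lt_one n) one_pos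
    obtain ⟨hi2, h2⟩ := poisson_approachingCircle hg' hg0 (one_div_add_two_pos n)
      (one_div_add_two_lt_one n) hτ0
    have hk1 : ∀ ω : ℝ, (1 : ℝ) / (1 ^ 2 + ω ^ 2) = (1 + ω ^ 2)⁻¹ := fun ω => by
      rw [one_pow, one_div]
    rw [mul_one, add_comm, div_self (by positivity), Complex.ofReal_one] at h1
    simp only [hk1] at hi1 h1
    rw [h1, h2, ← integral_add_compl hSm hi1, mul_add]
    have hcompl : τ / 2 * ∫ ω in Sᶜ, (1 + ω ^ 2)⁻¹ * Real.log ‖g (approachingCircle (e n) ω)‖ ≥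
        ∫ ω, τ / (τ ^ 2 + ω ^ 2) * Real.log ‖g (approachingCircle (e n) ω)‖ := by
      rw [← integral_add_compl hSm hi2, ← integral_const_mul]
      have hA : ∫ ω in S, τ / (τ ^ 2 + ω ^ 2) * Real.log ‖g (approachingCircle (e n) ω)‖ ≤ 0 :=
        integral_nonpos fun ω => mul_nonpos_of_nonneg_of_nonpos (by positivity) (hlog0 n ω)
      have hB : ∫ ω in Sᶜ, τ / (τ ^ 2 + ω ^ 2) * Real.log ‖g (approachingCircle (e n) ω)‖ ≤
          ∫ ω in Sᶜ, τ / 2 * ((1 + ω ^ 2)⁻¹ * Real.log ‖g (approachingCircle (e n) ω)‖) := by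
        refine setIntegral_mono_on hi2.integrableOn (hi1.const_mul _).integrableOn hSm.compl
          fun ω hω => ?_
        rw [← mul_assoc]
        refine mul_le_mul_of_nonpos_right ?_ (hlog0 n ω)
        have hω2 : τ ^ 2 ≤ ω ^ 2 := by
          rw [sq_le_sq, abs_of_pos hτ0]
          by_contra hlt
          rw [not_le, abs_lt] at hlt
          exact hω ⟨hlt.1.le, hlt.2.le⟩
        rw [← div_eq_mul_inv, div_div]
        exact div_le_div_of_nonneg_left hτ0.le (by positivity) (by nlinarith)
      linarith
    have hpi : 0 < Real.pi⁻¹ := inv_pos.2 Real.pi_pos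
    have := mul_le_mul_of_nonneg_left hcompl (by positivity : 0 ≤ Real.pi⁻¹ * (2 / τ))
    have h3 : Real.pi⁻¹ * (2 / τ) *
        (τ / 2 * ∫ ω in Sᶜ, (1 + ω ^ 2)⁻¹ * Real.log ‖g (approachingCircle (e n) ω)‖) =
        Real.pi⁻¹ * ∫ ω in Sᶜ, (1 + ω ^ 2)⁻¹ * Real.log ‖g (approachingCircle (e n) ω)‖ := by
      field_simp
    rw [h3] at this
    have h4 : 2 / τ * (Real.pi⁻¹ *
        ∫ ω, τ / (τ ^ 2 + ω ^ 2) * Real.log ‖g (approachingCircle (e n) ω)‖) =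
        Real.pi⁻¹ * (2 / τ) *
          ∫ ω, τ / (τ ^ 2 + ω ^ 2) * Real.log ‖g (approachingCircle (e n) ω)‖ := by ring
    rw [h4]
    linarith
  -- the limit of the left side, by dominated convergence
  have hlim1 : Tendsto (fun n => ∫ ω in S, (1 + ω ^ 2)⁻¹ *
      Real.log ‖g (approachingCircle (e n) ω)‖) atTop
      (𝓝 (∫ ω in S, (1 + ω ^ 2)⁻¹ * Real.log ‖g (ω * Complex.I)‖)) := by
    obtain ⟨c, hc, hcev⟩ := exists_mul_norm_le_approachingCircle hg hne
      (isCompact_Icc : IsCompact (Set.Icc (-τ) τ))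
    have hae := ae_restrict_of_ae (s := S) (ae_ne_zero_mul_I hg hne)
    refine tendsto_integral_filter_of_dominated_convergence
      (fun ω => -((1 + ω ^ 2)⁻¹ * Real.log ‖g (ω * Complex.I)‖) +
        (1 + ω ^ 2)⁻¹ * |Real.log c|) ?_ ?_ ?_ ?_
    · refine .of_forall fun n => ?_
      exact (log_norm_le_mean_approachingCircle hg' hg1 (one_div_add_two_pos n)
        (one_div_add_two_lt_one n)).1.aestronglyMeasurable.restrict
    · filter_upwards [tendsto_one_div_add_two.eventually hcev] with n hn
      filter_upwards [hae, ae_restrict_mem hSm] with ω hω hωS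
      have h1 := hn ω hωS
      have h2 : 0 < ‖g (ω * Complex.I)‖ := norm_pos_iff.2 hω
      have h3 := Real.log_le_log (by positivity) h1
      rw [Real.log_mul hc.ne' h2.ne'] at h3
      rw [norm_mul, Real.norm_of_nonneg (by positivity), Real.norm_of_nonpos (hlog0 n ω),
        ← mul_neg, ← mul_add]
      refine mul_le_mul_of_nonneg_left ?_ (by positivity)
      have := neg_abs_le (Real.log c)
      simp only [he]
      linarith
    · exact (hint.neg.integrableOn).add (integrable_inv_one_add_sq.mul_const _).integrableOn
    · filter_upwards [hae] with ω hω
      exact (((tendsto_norm_approachingCircle hg ω).comp tendsto_one_div_add_two).log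
        (norm_ne_zero_iff.2 hω)).const_mul _
  have hlim2 : Tendsto (fun n => Real.log ‖g ((τ + e n) / (1 + e n * τ) : ℝ)‖) atTop
      (𝓝 (Real.log ‖g τ‖)) := by
    have h1 : Tendsto (fun n => ((τ + e n) / (1 + e n * τ) : ℝ)) atTop (𝓝 τ) := by
      have : ContinuousAt (fun x : ℝ => (τ + x) / (1 + x * τ)) 0 := by
        refine ContinuousAt.div (by fun_prop) (by fun_prop) (by simp)
      rw [ContinuousAt] at this
      simp only [add_zero, zero_mul, div_one] at this
      exact this.comp tendsto_one_div_add_two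
    have h2 : ContinuousAt g (τ : ℂ) := (hg' τ (by simpa using hτ0)).continuousAt
    exact ((h2.tendsto.comp ((Complex.continuous_ofReal.tendsto τ).comp h1)).norm).log
      (norm_ne_zero_iff.2 (hg0 τ (by simpa using hτ0)))
  have hfin := le_of_tendsto_of_tendsto' (hlim1.const_mul Real.pi⁻¹)
    (tendsto_const_nhds.sub (hlim2.const_mul (2 / τ))) hstep
  have hmono : ∫ ω : ℝ, (1 + ω ^ 2)⁻¹ * Real.log ‖g (ω * Complex.I)‖ ≤
      ∫ ω in S, (1 + ω ^ 2)⁻¹ * Real.log ‖g (ω * Complex.I)‖ := by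
    rw [← integral_add_compl hSm hint]
    have : ∫ ω in Sᶜ, (1 + ω ^ 2)⁻¹ * Real.log ‖g (ω * Complex.I)‖ ≤ 0 :=
      integral_nonpos fun ω => mul_nonpos_of_nonneg_of_nonpos (by positivity) (hlogb ω)
    linarith
  have h5 := mul_le_mul_of_nonneg_left hmono (inv_pos.2 Real.pi_pos).le
  have h6 : -(2 / τ * Real.log ‖g τ‖) ≤ a := by
    have := mul_le_mul_of_nonneg_left hτa (by positivity : 0 ≤ 2 / τ)
    have h7 : 2 / τ * -(a / 2 * τ) = -a := by field_simp
    linarith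
  linarith

/-! ### Poisson representation at an arbitrary point -/

lemma integral_inv_one_add_sq_mul_const (c : ℝ) :
    ∫ ω : ℝ, (1 + ω ^ 2)⁻¹ * c = Real.pi * c := by
  rw [integral_mul_const, integral_univ_inv_one_add_sq]

lemma log_norm_div_ofReal {z : ℂ} (hz : z ≠ 0) {C : ℝ} (hC : 0 < C) :
    Real.log ‖z / (C : ℂ)‖ = Real.log ‖z‖ - Real.log C := by
  rw [norm_div, Complex.norm_real, Real.norm_of_nonneg hC.le,
    Real.log_div (norm_ne_zero_iff.2 hz) hC.ne']

lemma norm_div_ofReal_le_one {f : ℂ → ℂ} {C : ℝ} (hC : 0 < C)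
    (hb : ∀ s : ℂ, 0 < s.re → ‖f s‖ ≤ C) (s : ℂ) (hs : 0 < s.re) : ‖f s / (C : ℂ)‖ ≤ 1 := by
  rw [norm_div, Complex.norm_real, Real.norm_of_nonneg hC.le, div_le_one hC]
  exact hb s hs

lemma analyticOnNhd_div_ofReal {f : ℂ → ℂ} (hf : AnalyticOnNhd ℂ f {s | 0 ≤ s.re}) {C : ℝ}
    (hC : 0 < C) : AnalyticOnNhd ℂ (fun s => f s / (C : ℂ)) {s | 0 ≤ s.re} :=
  fun s hs => (hf s hs).div analyticAt_const (by exact_mod_cast hC.ne')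

lemma ae_log_norm_div_ofReal {f : ℂ → ℂ} (hf : AnalyticOnNhd ℂ f {s | 0 ≤ s.re}) (hf1 : f 1 ≠ 0)
    {C : ℝ} (hC : 0 < C) :
    (fun ω : ℝ => (1 + ω ^ 2)⁻¹ * Real.log ‖f (ω * Complex.I) / (C : ℂ)‖) =ᵐ[volume]
      fun ω : ℝ => (1 + ω ^ 2)⁻¹ * Real.log ‖f (ω * Complex.I)‖ - (1 + ω ^ 2)⁻¹ * Real.log C := by
  filter_upwards [ae_ne_zero_mul_I hf ⟨1, by simp, hf1⟩] with ω hω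
  rw [log_norm_div_ofReal hω hC, mul_sub]

theorem log_norm_one_le_integral {f : ℂ → ℂ}
    (hf : AnalyticOnNhd ℂ f {s | 0 ≤ s.re}) (hf1 : f 1 ≠ 0) {C : ℝ} (hC : 0 < C)
    (hb : ∀ s : ℂ, 0 < s.re → ‖f s‖ ≤ C) :
    (Integrable fun ω : ℝ => (1 + ω ^ 2)⁻¹ * Real.log ‖f (ω * Complex.I)‖) ∧
    Real.log ‖f 1‖ ≤ Real.pi⁻¹ * ∫ ω : ℝ, (1 + ω ^ 2)⁻¹ * Real.log ‖f (ω * Complex.I)‖ := by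
  have hC' : (C : ℂ) ≠ 0 := by exact_mod_cast hC.ne'
  obtain ⟨h1, h2⟩ := log_norm_one_le_integral_of_norm_le_one (analyticOnNhd_div_ofReal hf hC)
    (div_ne_zero hf1 hC') (norm_div_ofReal_le_one hC hb)
  have hae := ae_log_norm_div_ofReal hf hf1 hC
  have hc : Integrable fun ω : ℝ => (1 + ω ^ 2)⁻¹ * Real.log C :=
    integrable_inv_one_add_sq.mul_const _
  have hi : Integrable fun ω : ℝ => (1 + ω ^ 2)⁻¹ * Real.log ‖f (ω * Complex.I)‖ := by
    refine ((h1.congr hae).add hc).congr (.of_forall fun ω => ?_)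
    simp only [Pi.add_apply, sub_add_cancel]
  refine ⟨hi, ?_⟩
  rw [integral_congr_ae hae, integral_sub hi hc, integral_inv_one_add_sq_mul_const,
    log_norm_div_ofReal hf1 hC, mul_sub, inv_mul_cancel_left₀ Real.pi_ne_zero] at h2
  linarith

theorem integral_le_log_norm_one {g : ℂ → ℂ}
    (hg : AnalyticOnNhd ℂ g {s | 0 ≤ s.re}) (hg0 : ∀ s : ℂ, 0 < s.re → g s ≠ 0)
    {C : ℝ} (hC : 0 < C) (hb : ∀ s : ℂ, 0 < s.re → ‖g s‖ ≤ C)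
    (hdecay : ∀ a : ℝ, 0 < a → ∀ᶠ τ : ℝ in atTop, -(a * τ) ≤ Real.log ‖g τ‖) :
    Real.pi⁻¹ * ∫ ω : ℝ, (1 + ω ^ 2)⁻¹ * Real.log ‖g (ω * Complex.I)‖ ≤ Real.log ‖g 1‖ := by
  have hC' : (C : ℂ) ≠ 0 := by exact_mod_cast hC.ne'
  have hg1 : g 1 ≠ 0 := hg0 1 (by simp)
  have h2 := integral_le_log_norm_one_of_norm_le_one (analyticOnNhd_div_ofReal hg hC)
    (fun s hs => div_ne_zero (hg0 s hs) hC') (norm_div_ofReal_le_one hC hb) (by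
      intro a ha
      filter_upwards [hdecay (a / 2) (by positivity), eventually_gt_atTop 0,
        eventually_ge_atTop (Real.log C / (a / 2))] with τ h1 h2 h3
      rw [log_norm_div_ofReal (hg0 _ (by simpa using h2)) hC]
      rw [div_le_iff₀ (by positivity)] at h3
      linarith)
  have hi := (log_norm_one_le_integral hg hg1 hC hb).1
  rw [integral_congr_ae (ae_log_norm_div_ofReal hg hg1 hC),
    integral_sub hi (integrable_inv_one_add_sq.mul_const _), integral_inv_one_add_sq_mul_const,
    log_norm_div_ofReal hg1 hC, mul_sub, inv_mul_cancel_left₀ Real.pi_ne_zero] at h2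
  linarith

/-- The affine substitution carrying the Cauchy density to the Poisson kernel of `σ + iy`. -/
lemma integral_poissonKernel_eq {σ : ℝ} (hσ : 0 < σ) (y : ℝ) (k : ℝ → ℝ) :
    ∫ ω : ℝ, σ / (σ ^ 2 + (y - ω) ^ 2) * k ω = ∫ ω : ℝ, (1 + ω ^ 2)⁻¹ * k (y + σ * ω) := by
  have h1 := integral_add_left_eq_self (μ := (volume : Measure ℝ))
    (fun ω : ℝ => σ / (σ ^ 2 + (y - ω) ^ 2) * k ω) y
  have h2 := Measure.integral_comp_mul_left
    (fun ω : ℝ => σ / (σ ^ 2 + (y - (y + ω)) ^ 2) * k (y + ω)) σ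
  rw [h1, smul_eq_mul, abs_of_pos (inv_pos.2 hσ)] at h2
  rw [← mul_right_inj' (inv_ne_zero hσ.ne'), ← h2, ← integral_const_mul]
  congr 1
  ext ω
  have : (0 : ℝ) < 1 + ω ^ 2 := by positivity
  have h3 : σ ^ 2 + (y - (y + σ * ω)) ^ 2 = σ ^ 2 * (1 + ω ^ 2) := by ring
  rw [h3]
  field_simp

lemma integrable_poissonKernel_iff {σ : ℝ} (hσ : 0 < σ) (y : ℝ) (k : ℝ → ℝ) :
    (Integrable fun ω : ℝ => σ / (σ ^ 2 + (y - ω) ^ 2) * k ω) ↔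
      Integrable fun ω : ℝ => (1 + ω ^ 2)⁻¹ * k (y + σ * ω) := by
  rw [← (measurePreserving_add_left (volume : Measure ℝ) y).integrable_comp_emb
      (measurableEmbedding_addLeft y),
    ← integrable_comp_mul_left_iff _ hσ.ne', ← integrable_const_mul_iff (isUnit_iff_ne_zero.2 hσ.ne')]
  refine integrable_congr (.of_forall fun ω => ?_)
  have : (0 : ℝ) < 1 + ω ^ 2 := by positivity
  have h3 : σ ^ 2 + (y - (y + σ * ω)) ^ 2 = σ ^ 2 * (1 + ω ^ 2) := by ring
  simp only [Function.comp_apply]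
  rw [h3]
  field_simp

lemma analyticOnNhd_comp_affine {f : ℂ → ℂ} (hf : AnalyticOnNhd ℂ f {s | 0 ≤ s.re}) {σ : ℝ}
    (hσ : 0 < σ) (y : ℝ) :
    AnalyticOnNhd ℂ (fun s => f (σ * s + y * Complex.I)) {s | 0 ≤ s.re} := by
  intro s hs
  refine AnalyticAt.fun_comp (g := f) (hf _ ?_)
    ((analyticAt_const.mul analyticAt_id).add analyticAt_const)
  simpa using mul_nonneg hσ.le hs

lemma re_mul_I_add (σ ω y : ℝ) :
    (σ * (ω * Complex.I) + y * Complex.I : ℂ) = ((y + σ * ω : ℝ) : ℂ) * Complex.I := by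
  push_cast; ring

/-- The subharmonicity estimate `log |f| ≤` Poisson integral of its boundary values, for `f`
bounded and analytic across the imaginary axis. -/
theorem log_norm_le_poisson {f : ℂ → ℂ} (hf : AnalyticOnNhd ℂ f {s | 0 ≤ s.re})
    {C : ℝ} (hC : 0 < C) (hb : ∀ s : ℂ, 0 < s.re → ‖f s‖ ≤ C) {s : ℂ} (hs : 0 < s.re)
    (hfs : f s ≠ 0) :
    (Integrable fun ω : ℝ =>
      s.re / (s.re ^ 2 + (s.im - ω) ^ 2) * Real.log ‖f (ω * Complex.I)‖) ∧
    Real.log ‖f s‖ ≤ (1 / Real.pi) *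
      ∫ ω : ℝ, s.re / (s.re ^ 2 + (s.im - ω) ^ 2) * Real.log ‖f (ω * Complex.I)‖ := by
  have hs1 : (s.re * 1 + s.im * Complex.I : ℂ) = s := by rw [mul_one, Complex.re_add_im]
  have h := log_norm_one_le_integral (analyticOnNhd_comp_affine hf hs s.im)
    (by simp only [hs1]; exact hfs) hC (fun z hz => hb _ (by simpa using mul_pos hs hz))
  simp only [hs1, re_mul_I_add] at h
  rwa [integrable_poissonKernel_iff hs s.im (fun ω => Real.log ‖f (ω * Complex.I)‖),
    integral_poissonKernel_eq hs s.im (fun ω => Real.log ‖f (ω * Complex.I)‖), one_div]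

/-! ### Outer functions that are analytic across the imaginary axis -/

/-- A sufficient condition for a bounded function to be outer: it is analytic on a neighbourhood of
the closed right half-plane, zero-free in the open one, and does not decay exponentially along
horizontal rays. -/
structure IsRegularOuter (g : ℂ → ℂ) : Prop where
  analytic : AnalyticOnNhd ℂ g {s | 0 ≤ s.re}
  ne_zero : ∀ s : ℂ, 0 < s.re → g s ≠ 0
  bounded : ∃ C : ℝ, ∀ s : ℂ, 0 < s.re → ‖g s‖ ≤ C
  decay : ∀ y a : ℝ, 0 < a → ∀ᶠ τ : ℝ in atTop, -(a * τ) ≤ Real.log ‖g (τ + y * Complex.I)‖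

lemma exists_pos_bound {f : ℂ → ℂ} (h : ∃ C : ℝ, ∀ s : ℂ, 0 < s.re → ‖f s‖ ≤ C) :
    ∃ C : ℝ, 0 < C ∧ ∀ s : ℂ, 0 < s.re → ‖f s‖ ≤ C := by
  obtain ⟨C, hC⟩ := h
  exact ⟨max C 1, by positivity, fun s hs => (hC s hs).trans (le_max_left _ _)⟩

namespace IsRegularOuter

theorem poisson {g : ℂ → ℂ} (hg : IsRegularOuter g) {s : ℂ} (hs : 0 < s.re) :
    (Integrable fun ω : ℝ =>
      s.re / (s.re ^ 2 + (s.im - ω) ^ 2) * Real.log ‖g (ω * Complex.I)‖) ∧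
    Real.log ‖g s‖ = (1 / Real.pi) *
      ∫ ω : ℝ, s.re / (s.re ^ 2 + (s.im - ω) ^ 2) * Real.log ‖g (ω * Complex.I)‖ := by
  obtain ⟨C, hC, hb⟩ := exists_pos_bound hg.bounded
  obtain ⟨hi, hle⟩ := log_norm_le_poisson hg.analytic hC hb hs (hg.ne_zero s hs)
  refine ⟨hi, le_antisymm hle ?_⟩
  have hs1 : (s.re * 1 + s.im * Complex.I : ℂ) = s := by rw [mul_one, Complex.re_add_im]
  have h := integral_le_log_norm_one (analyticOnNhd_comp_affine hg.analytic hs s.im)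
    (fun z hz => hg.ne_zero _ (by simpa using mul_pos hs hz)) hC
    (fun z hz => hb _ (by simpa using mul_pos hs hz)) (by
      intro a ha
      have h1 := (tendsto_id.const_mul_atTop hs).eventually
        (hg.decay s.im (a / s.re) (div_pos ha hs))
      filter_upwards [h1] with τ hτ
      simp only [id] at hτ
      rw [show a / s.re * (s.re * τ) = a * τ by field_simp] at hτ
      simpa using hτ)
  simp only [hs1, re_mul_I_add] at h
  rwa [integral_poissonKernel_eq hs s.im (fun ω => Real.log ‖g (ω * Complex.I)‖), one_div]

lemma ae_ne_zero {g : ℂ → ℂ} (hg : IsRegularOuter g) : ∀ᵐ ω : ℝ, g (ω * Complex.I) ≠ 0 :=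
  ae_ne_zero_mul_I hg.analytic ⟨1, by simp, hg.ne_zero 1 (by simp)⟩

lemma integrable_log_div {g : ℂ → ℂ} (hg : IsRegularOuter g) :
    Integrable fun ω : ℝ => Real.log ‖g (ω * Complex.I)‖ / (1 + ω ^ 2) := by
  have h := (hg.poisson (s := 1) (by simp)).1
  simpa [div_eq_inv_mul] using h

lemma log_norm_div {g₁ g₂ : ℂ → ℂ} (h₁ : IsRegularOuter g₁) (h₂ : IsRegularOuter g₂) {s : ℂ}
    (hs : 0 < s.re) :
    Real.log ‖g₁ s / g₂ s‖ = (1 / Real.pi) *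
      ∫ ω : ℝ, s.re / (s.re ^ 2 + (s.im - ω) ^ 2) *
        (Real.log ‖g₁ (ω * Complex.I)‖ - Real.log ‖g₂ (ω * Complex.I)‖) := by
  obtain ⟨i₁, e₁⟩ := h₁.poisson hs
  obtain ⟨i₂, e₂⟩ := h₂.poisson hs
  rw [norm_div, Real.log_div (norm_ne_zero_iff.2 (h₁.ne_zero s hs))
    (norm_ne_zero_iff.2 (h₂.ne_zero s hs)), e₁, e₂, ← mul_sub, ← integral_sub i₁ i₂]
  simp only [mul_sub]

theorem isOuter_div {g₁ g₂ : ℂ → ℂ} (h₁ : IsRegularOuter g₁) (h₂ : IsRegularOuter g₂) :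
    IsOuter fun s => g₁ s / g₂ s where
  holomorphic := fun s (hs : 0 < s.re) =>
    ((h₁.analytic s hs.le).div (h₂.analytic s hs.le)
      (h₂.ne_zero s hs)).differentiableAt.differentiableWithinAt
  ne_zero := fun s hs => div_ne_zero (h₁.ne_zero s hs) (h₂.ne_zero s hs)
  poisson := by
    refine ⟨fun ω => Real.log ‖g₁ (ω * Complex.I)‖ - Real.log ‖g₂ (ω * Complex.I)‖, ?_,
      fun s hs => log_norm_div h₁ h₂ hs⟩
    simpa only [sub_div, Pi.sub_def] using h₁.integrable_log_div.sub h₂.integrable_log_div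

/-- A quotient of regular outer functions is bounded in the half-plane as soon as it is bounded on
the imaginary axis: the boundary bound passes through the Poisson integral. -/
theorem bounded_div {g₁ g₂ : ℂ → ℂ} (h₁ : IsRegularOuter g₁) (h₂ : IsRegularOuter g₂) {C : ℝ}
    (hC : ∀ᵐ ω : ℝ, ‖g₁ (ω * Complex.I) / g₂ (ω * Complex.I)‖ ≤ C) :
    ∃ C : ℝ, ∀ s : ℂ, 0 < s.re → ‖g₁ s / g₂ s‖ ≤ C := by
  -- passing to `max C 1` makes the logarithm of the bound meaningful for every `C`
  refine ⟨max C 1, fun s hs => ?_⟩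
  set D := max C 1 with hD
  have hDpos : 0 < D := by positivity
  have hpos : 0 < ‖g₁ s / g₂ s‖ :=
    norm_pos_iff.2 (div_ne_zero (h₁.ne_zero s hs) (h₂.ne_zero s hs))
  rw [← Real.log_le_log_iff hpos hDpos, log_norm_div h₁ h₂ hs]
  have hi : Integrable fun ω : ℝ => s.re / (s.re ^ 2 + (s.im - ω) ^ 2) * Real.log D := by
    rw [integrable_poissonKernel_iff hs s.im fun _ => Real.log D]
    exact integrable_inv_one_add_sq.mul_const _
  have hint : ∫ ω : ℝ, s.re / (s.re ^ 2 + (s.im - ω) ^ 2) * Real.log D = Real.pi * Real.log D := by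
    rw [integral_poissonKernel_eq hs s.im fun _ => Real.log D, integral_inv_one_add_sq_mul_const]
  have hle : ∫ ω : ℝ, s.re / (s.re ^ 2 + (s.im - ω) ^ 2) *
        (Real.log ‖g₁ (ω * Complex.I)‖ - Real.log ‖g₂ (ω * Complex.I)‖) ≤
      ∫ ω : ℝ, s.re / (s.re ^ 2 + (s.im - ω) ^ 2) * Real.log D := by
    refine integral_mono_ae ?_ hi ?_
    · simpa only [mul_sub, Pi.sub_def] using (h₁.poisson hs).1.sub (h₂.poisson hs).1
    · filter_upwards [h₁.ae_ne_zero, h₂.ae_ne_zero, hC] with ω n₁ n₂ hω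
      refine mul_le_mul_of_nonneg_left ?_ (div_nonneg hs.le (by positivity))
      rw [← Real.log_div (norm_ne_zero_iff.2 n₁) (norm_ne_zero_iff.2 n₂), ← norm_div]
      exact Real.log_le_log (norm_pos_iff.2 (div_ne_zero n₁ n₂)) (hω.trans (le_max_left _ _))
  rw [hint] at hle
  rw [one_div, inv_mul_le_iff₀ Real.pi_pos]
  exact hle

/-- Dividing a bounded function by a regular outer function with the same modulus on the imaginary
axis gives an inner function, even when the numerator has infinitely many zeros. -/
theorem isInner_div {f g : ℂ → ℂ} (hg : IsRegularOuter g) (hf : AnalyticOnNhd ℂ f {s | 0 ≤ s.re})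
    (hb : ∃ C : ℝ, ∀ s : ℂ, 0 < s.re → ‖f s‖ ≤ C)
    (hfg : ∀ ω : ℝ, ‖f (ω * Complex.I)‖ = ‖g (ω * Complex.I)‖) :
    IsInner fun s => f s / g s where
  holomorphic := fun s (hs : 0 < s.re) => ((hf s hs.le).div (hg.analytic s hs.le)
      (hg.ne_zero s hs)).differentiableAt.differentiableWithinAt
  norm_le_one := by
    intro s hs
    obtain ⟨C, hC, hbC⟩ := exists_pos_bound hb
    have hpos : 0 < ‖g s‖ := norm_pos_iff.2 (hg.ne_zero s hs)
    rw [norm_div, div_le_one hpos]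
    by_cases hfs : f s = 0
    · rw [hfs, norm_zero]; exact hpos.le
    · have h := (log_norm_le_poisson hf hC hbC hs hfs).2
      simp only [hfg] at h
      rw [← (hg.poisson hs).2] at h
      exact (Real.log_le_log_iff (norm_pos_iff.2 hfs) hpos).1 h
  boundary := by
    filter_upwards [hg.ae_ne_zero] with ω hω
    have hpath : Tendsto (fun σ : ℝ => (σ + ω * Complex.I : ℂ)) (𝓝[>] 0) (𝓝 (ω * Complex.I)) :=
      (Continuous.tendsto' (by fun_prop) _ _ (by simp)).mono_left nhdsWithin_le_nhds
    have h1 := (((hf _ (by simp)).continuousAt.tendsto.comp hpath).div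
      ((hg.analytic _ (by simp)).continuousAt.tendsto.comp hpath) hω).norm
    rw [norm_div, hfg, div_self (norm_ne_zero_iff.2 hω)] at h1
    exact h1

end IsRegularOuter

/-! ### Finite Blaschke products and the extraction of zeros -/

/-- The finite Blaschke product of the right half-plane with zeros `z ∈ Z` of multiplicity `n z`. -/
noncomputable def blaschkeProduct (Z : Finset ℂ) (n : ℂ → ℕ) (s : ℂ) : ℂ :=
  ∏ z ∈ Z, ((s - z) / (s + conj z)) ^ n z

lemma add_conj_ne_zero {s z : ℂ} (hs : 0 ≤ s.re) (hz : 0 < z.re) : s + conj z ≠ 0 := by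
  intro h
  have := congrArg Complex.re h
  simp at this
  linarith

lemma norm_blaschkeFactor_le_one {s z : ℂ} (hs : 0 ≤ s.re) (hz : 0 < z.re) :
    ‖(s - z) / (s + conj z)‖ ≤ 1 := by
  rw [norm_div, div_le_one (norm_pos_iff.2 (add_conj_ne_zero hs hz)), ← sq_le_sq₀ (norm_nonneg _)
    (norm_nonneg _), ← Complex.normSq_eq_norm_sq, ← Complex.normSq_eq_norm_sq,
    Complex.normSq_apply, Complex.normSq_apply]
  simp
  nlinarith [mul_nonneg hs hz.le]

lemma norm_blaschkeFactor_mul_I {z : ℂ} (hz : 0 < z.re) (ω : ℝ) :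
    ‖(ω * Complex.I - z) / (ω * Complex.I + conj z)‖ = 1 := by
  rw [norm_div, div_eq_one_iff_eq (norm_ne_zero_iff.2 (add_conj_ne_zero (by simp) hz)),
    ← norm_neg, ← Complex.norm_conj]
  congr 1
  simp [add_comm]

section Blaschke

variable {Z : Finset ℂ} {n : ℂ → ℕ}

lemma analyticOnNhd_blaschkeProduct (hZ : ∀ z ∈ Z, 0 < z.re) :
    AnalyticOnNhd ℂ (blaschkeProduct Z n) {s | 0 ≤ s.re} := by
  intro s hs
  unfold blaschkeProduct
  refine Finset.analyticAt_fun_prod _ fun z hz => ?_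
  exact ((analyticAt_id.sub analyticAt_const).div (analyticAt_id.add analyticAt_const)
    (add_conj_ne_zero hs (hZ z hz))).pow _

lemma norm_blaschkeProduct_le_one (hZ : ∀ z ∈ Z, 0 < z.re) {s : ℂ} (hs : 0 ≤ s.re) :
    ‖blaschkeProduct Z n s‖ ≤ 1 := by
  rw [blaschkeProduct, norm_prod]
  refine Finset.prod_le_one (fun _ _ => norm_nonneg _) fun z hz => ?_
  rw [norm_pow]
  exact pow_le_one₀ (norm_nonneg _) (norm_blaschkeFactor_le_one hs (hZ z hz))

lemma norm_blaschkeProduct_mul_I (hZ : ∀ z ∈ Z, 0 < z.re) (ω : ℝ) :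
    ‖blaschkeProduct Z n (ω * Complex.I)‖ = 1 := by
  rw [blaschkeProduct, norm_prod]
  refine Finset.prod_eq_one fun z hz => ?_
  rw [norm_pow, norm_blaschkeFactor_mul_I (hZ z hz), one_pow]

lemma blaschkeProduct_ne_zero (hZ : ∀ z ∈ Z, 0 < z.re) {s : ℂ} (hs : 0 ≤ s.re) (hsZ : s ∉ Z) :
    blaschkeProduct Z n s ≠ 0 := by
  rw [blaschkeProduct, Finset.prod_ne_zero_iff]
  intro z hz
  refine pow_ne_zero _ (div_ne_zero (sub_ne_zero.2 ?_) (add_conj_ne_zero hs (hZ z hz)))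
  rintro rfl
  exact hsZ hz

lemma tendsto_blaschkeProduct : Tendsto (blaschkeProduct Z n) (Bornology.cobounded ℂ) (𝓝 1) := by
  have h : ∀ z ∈ Z, Tendsto (fun s : ℂ => ((s - z) / (s + conj z)) ^ n z)
      (Bornology.cobounded ℂ) (𝓝 1) := by
    intro z _
    have h1 : Tendsto (fun s : ℂ => s + conj z) (Bornology.cobounded ℂ) (Bornology.cobounded ℂ) :=
      tendsto_add_const_cobounded _
    have h2 : Tendsto (fun s : ℂ => 1 - (z + conj z) * (s + conj z)⁻¹) (Bornology.cobounded ℂ)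
        (𝓝 1) := by
      simpa using ((tendsto_inv₀_cobounded.comp h1).const_mul (z + conj z)).const_sub 1
    have h3 : Tendsto (fun s : ℂ => (s - z) / (s + conj z)) (Bornology.cobounded ℂ) (𝓝 1) := by
      refine h2.congr' ?_
      filter_upwards [h1.eventually_ne_cobounded 0] with s hs
      field_simp
      ring
    simpa using h3.pow (n z)
  have := tendsto_finsetProd Z h
  rwa [Finset.prod_const_one] at this

lemma isInner_of_analyticOnNhd {m : ℂ → ℂ} (hm : AnalyticOnNhd ℂ m {s | 0 ≤ s.re})
    (h1 : ∀ s : ℂ, 0 < s.re → ‖m s‖ ≤ 1) (h2 : ∀ ω : ℝ, ‖m (ω * Complex.I)‖ = 1) : IsInner m where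
  holomorphic := fun s (hs : 0 < s.re) => (hm s hs.le).differentiableAt.differentiableWithinAt
  norm_le_one := h1
  boundary := by
    refine .of_forall fun ω => ?_
    have hpath : Tendsto (fun σ : ℝ => (σ + ω * Complex.I : ℂ)) (𝓝[>] 0) (𝓝 (ω * Complex.I)) :=
      (Continuous.tendsto' (by fun_prop) _ _ (by simp)).mono_left nhdsWithin_le_nhds
    have h := ((hm _ (by simp)).continuousAt.tendsto.comp hpath).norm
    rwa [h2] at h

lemma isInner_blaschkeProduct (hZ : ∀ z ∈ Z, 0 < z.re) : IsInner (blaschkeProduct Z n) :=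
  isInner_of_analyticOnNhd (analyticOnNhd_blaschkeProduct hZ)
    (fun _ hs => norm_blaschkeProduct_le_one hZ hs.le) (norm_blaschkeProduct_mul_I hZ)

lemma IsInner.mul {m₁ m₂ : ℂ → ℂ} (h₁ : IsInner m₁) (h₂ : IsInner m₂) :
    IsInner fun s => m₁ s * m₂ s where
  holomorphic := h₁.holomorphic.mul h₂.holomorphic
  norm_le_one s hs := by
    rw [norm_mul]
    exact mul_le_one₀ (h₁.norm_le_one s hs) (norm_nonneg _) (h₂.norm_le_one s hs)
  boundary := by
    filter_upwards [h₁.boundary, h₂.boundary] with ω a b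
    simpa using a.mul b

lemma isInner_exp {c : ℝ} (hc : 0 ≤ c) : IsInner fun s => Complex.exp (-(c : ℂ) * s) := by
  refine isInner_of_analyticOnNhd
    (fun s _ => (analyticAt_const.mul analyticAt_id).cexp) (fun s hs => ?_) fun ω => ?_
  · rw [Complex.norm_exp, Real.exp_le_one_iff]
    simpa using mul_nonneg hc hs.le
  · rw [Complex.norm_exp, Real.exp_eq_one_iff]
    simp

lemma exists_real_polynomial_map_eq {P : ℂ[X]} (hP : P.map (starRingEnd ℂ) = P) :
    ∃ p : ℝ[X], p.map (algebraMap ℝ ℂ) = P := by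
  refine (Polynomial.mem_lifts _).1 ((Polynomial.lifts_iff_coeff_lifts _).2 fun k => ?_)
  refine ⟨(P.coeff k).re, ?_⟩
  refine Complex.conj_eq_iff_re.1 ?_
  conv_rhs => rw [← hP]
  rw [Polynomial.coeff_map]

/-- Conjugation symmetry of the zeros makes numerator and denominator real polynomials. -/
lemma isFiniteDimensional_blaschkeProduct (hZ : ∀ z ∈ Z, 0 < z.re)
    (hconj : ∀ z ∈ Z, conj z ∈ Z) (hn : ∀ z ∈ Z, n (conj z) = n z) :
    IsFiniteDimensional (blaschkeProduct Z n) := by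
  have hreal : ∀ φ : ℂ → ℂ, (∀ z, conj (φ z) = φ (conj z)) →
      ∃ p : ℝ[X], p.map (algebraMap ℝ ℂ) = ∏ z ∈ Z, (X - C (φ z)) ^ n z := by
    intro φ hφ
    refine exists_real_polynomial_map_eq ?_
    rw [Polynomial.map_prod]
    refine Finset.prod_bij' (fun z _ => conj z) (fun z _ => conj z) hconj hconj
      (fun z _ => Complex.conj_conj z) (fun z _ => Complex.conj_conj z) fun z hz => ?_
    rw [hn z hz, Polynomial.map_pow, Polynomial.map_sub, Polynomial.map_X, Polynomial.map_C, hφ]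
  obtain ⟨p, hp⟩ := hreal (fun z => z) fun _ => rfl
  obtain ⟨q, hq⟩ := hreal (fun z => -conj z) fun z => by simp
  have hpe : ∀ s : ℂ, aeval s p = ∏ z ∈ Z, (s - z) ^ n z := fun s => by
    rw [← Polynomial.eval_map_algebraMap, hp, Polynomial.eval_prod]
    simp
  have hqe : ∀ s : ℂ, aeval s q = ∏ z ∈ Z, (s + conj z) ^ n z := fun s => by
    rw [← Polynomial.eval_map_algebraMap, hq, Polynomial.eval_prod]
    simp
  refine ⟨p, q, fun s hs => ?_, fun s hs => ?_⟩
  · rw [hqe, Finset.prod_ne_zero_iff]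
    exact fun z hz => pow_ne_zero _ (add_conj_ne_zero hs (hZ z hz))
  · rw [hpe, hqe, ← Finset.prod_div_distrib]
    simp only [blaschkeProduct, div_pow]

/-- Finitely many zeros in the open half-plane can be divided out within the functions analytic on
the closed half-plane. -/
lemma exists_eq_prod_mul {f : ℂ → ℂ} (hf : AnalyticOnNhd ℂ f {s | 0 ≤ s.re})
    (hne : ∃ s : ℂ, 0 ≤ s.re ∧ f s ≠ 0) (hZ : ∀ z ∈ Z, 0 < z.re) :
    ∃ g : ℂ → ℂ, AnalyticOnNhd ℂ g {s | 0 ≤ s.re} ∧ (∀ z ∈ Z, g z ≠ 0) ∧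
      ∀ s, f s = (∏ z ∈ Z, (s - z) ^ analyticOrderNatAt f z) * g s := by
  classical
  induction Z using Finset.induction_on with
  | empty => exact ⟨f, hf, by simp, by simp⟩
  | insert w Z hw ih =>
    obtain ⟨g, hg, hg0, hfg⟩ := ih fun z hz => hZ z (Finset.mem_insert_of_mem hz)
    have hwre : 0 < w.re := hZ w (Finset.mem_insert_self _ _)
    set P : ℂ → ℂ := fun s => ∏ z ∈ Z, (s - z) ^ analyticOrderNatAt f z with hP
    have hPa : ∀ s, AnalyticAt ℂ P s := fun s =>
      Finset.analyticAt_fun_prod _ fun z _ => (analyticAt_id.sub analyticAt_const).pow _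
    have hPw : P w ≠ 0 := by
      refine Finset.prod_ne_zero_iff.2 fun z hz => pow_ne_zero _ (sub_ne_zero.2 ?_)
      rintro rfl
      exact hw hz
    have hfw := hf w hwre.le
    have hgw := hg w hwre.le
    have hfin : analyticOrderAt f w ≠ ⊤ := by
      rw [Ne, analyticOrderAt_eq_top]
      exact not_eventually_eq_zero hf hne hwre.le
    have hord : analyticOrderAt g w = (analyticOrderNatAt f w : ℕ) := by
      have h1 : analyticOrderAt f w = analyticOrderAt P w + analyticOrderAt g w := by
        rw [← analyticOrderAt_mul (hPa w) hgw]
        exact analyticOrderAt_congr (.of_forall hfg)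
      rw [(hPa w).analyticOrderAt_eq_zero.2 hPw, zero_add] at h1
      rw [← h1, Nat.cast_analyticOrderNatAt hfin]
    obtain ⟨h, hh, hh0, heq⟩ := hgw.analyticOrderAt_eq_natCast.1 hord
    set N := analyticOrderNatAt f w with hN
    set G : ℂ → ℂ := Function.update (fun s => g s / (s - w) ^ N) w (h w) with hG
    have hGne : ∀ s, s ≠ w → G s = g s / (s - w) ^ N := fun s hs => by
      rw [hG, Function.update_of_ne hs]
    have hgG : ∀ s, g s = (s - w) ^ N * G s := by
      intro s
      by_cases hs : s = w
      · subst hs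
        rw [hG, Function.update_self, heq.self_of_nhds, smul_eq_mul]
      · rw [hGne s hs, mul_div_cancel₀ _ (pow_ne_zero _ (sub_ne_zero.2 hs))]
    refine ⟨G, fun s hs => ?_, fun z hz => ?_, fun s => ?_⟩
    · by_cases hsw : s = w
      · subst hsw
        refine hh.congr ?_
        filter_upwards [heq] with t ht
        by_cases hts : t = s
        · rw [hts, hG, Function.update_self]
        · rw [hGne t hts, ht, smul_eq_mul,
            mul_div_cancel_left₀ _ (pow_ne_zero _ (sub_ne_zero.2 hts))]
      · refine ((hg s hs).div ((analyticAt_id.sub analyticAt_const).pow N)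
          (pow_ne_zero _ (sub_ne_zero.2 hsw))).congr ?_
        filter_upwards [isOpen_ne.mem_nhds hsw] with t ht
        exact (hGne t ht).symm
    · rcases Finset.mem_insert.1 hz with rfl | hz
      · rw [hG, Function.update_self]; exact hh0
      · have := hg0 z hz
        rw [hgG z] at this
        exact right_ne_zero_of_mul this
    · rw [Finset.prod_insert hw, hfg s, hgG s]
      ring

/-- A bounded function with finitely many zeros in the open half-plane, analytic across the
imaginary axis and without exponential decay, is a finite Blaschke product times an outer
function. -/
theorem exists_isRegularOuter_eq_blaschkeProduct_mul {f : ℂ → ℂ}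
    (hf : AnalyticOnNhd ℂ f {s | 0 ≤ s.re}) (hb : ∃ C : ℝ, ∀ s : ℂ, 0 < s.re → ‖f s‖ ≤ C)
    (hdecay : ∀ y a : ℝ, 0 < a → ∀ᶠ τ : ℝ in atTop,
      Real.exp (-(a * τ)) ≤ ‖f (τ + y * Complex.I)‖)
    (hZ : ∀ s, s ∈ Z ↔ 0 < s.re ∧ f s = 0) :
    ∃ g : ℂ → ℂ, IsRegularOuter g ∧
      ∀ s : ℂ, 0 ≤ s.re → f s = blaschkeProduct Z (analyticOrderNatAt f) s * g s := by
  have hZre : ∀ z ∈ Z, 0 < z.re := fun z hz => ((hZ z).1 hz).1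
  have hne : ∃ s : ℂ, 0 ≤ s.re ∧ f s ≠ 0 := by
    obtain ⟨τ, h1, h2⟩ := ((hdecay 0 1 one_pos).and (eventually_ge_atTop 0)).exists
    exact ⟨_, by simpa using h2, norm_pos_iff.1 ((Real.exp_pos _).trans_le h1)⟩
  obtain ⟨g, hg, hgZ, hfg⟩ := exists_eq_prod_mul hf hne hZre
  set n := analyticOrderNatAt f with hn
  set G : ℂ → ℂ := fun s => (∏ z ∈ Z, (s + conj z) ^ n z) * g s with hG
  have hfG : ∀ s : ℂ, 0 ≤ s.re → f s = blaschkeProduct Z n s * G s := by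
    intro s hs
    rw [hfg s, hG, blaschkeProduct, ← mul_assoc, ← Finset.prod_mul_distrib]
    congr 1
    refine Finset.prod_congr rfl fun z hz => ?_
    rw [← mul_pow, div_mul_cancel₀ _ (add_conj_ne_zero hs (hZre z hz))]
  have hGa : AnalyticOnNhd ℂ G {s | 0 ≤ s.re} := fun s hs =>
    (Finset.analyticAt_fun_prod _ fun z _ => (analyticAt_id.add analyticAt_const).pow _).mul
      (hg s hs)
  have hfle : ∀ s : ℂ, 0 ≤ s.re → ‖f s‖ ≤ ‖G s‖ := by
    intro s hs
    rw [hfG s hs, norm_mul]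
    exact mul_le_of_le_one_left (norm_nonneg _) (norm_blaschkeProduct_le_one hZre hs)
  refine ⟨G, ⟨hGa, fun s hs => ?_, ?_, fun y a ha => ?_⟩, hfG⟩
  · refine mul_ne_zero (Finset.prod_ne_zero_iff.2 fun z hz =>
      pow_ne_zero _ (add_conj_ne_zero hs.le (hZre z hz))) ?_
    by_cases hsZ : s ∈ Z
    · exact hgZ s hsZ
    · intro h0
      exact hsZ ((hZ s).2 ⟨hs, by rw [hfg s, h0, mul_zero]⟩)
  · obtain ⟨C, hC⟩ := hb
    have h1 : ∀ᶠ s in Bornology.cobounded ℂ, 1 / 2 < ‖blaschkeProduct Z n s‖ := by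
      have := (tendsto_blaschkeProduct (Z := Z) (n := n)).norm
      rw [norm_one] at this
      exact this.eventually (lt_mem_nhds (by norm_num))
    obtain ⟨r, -, hr⟩ := (Metric.hasBasis_cobounded_compl_closedBall (0 : ℂ)).eventually_iff.1 h1
    have hK : IsCompact (Metric.closedBall (0 : ℂ) r ∩ {s | 0 ≤ s.re}) :=
      (isCompact_closedBall _ _).inter_right (isClosed_le continuous_const Complex.continuous_re)
    obtain ⟨D, hD⟩ := hK.exists_bound_of_continuousOn
      (hGa.continuousOn.mono Set.inter_subset_right)
    refine ⟨max D (2 * C), fun s hs => ?_⟩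
    by_cases hsr : s ∈ Metric.closedBall (0 : ℂ) r
    · exact (hD s ⟨hsr, hs.le⟩).trans (le_max_left _ _)
    · refine le_trans ?_ (le_max_right _ _)
      have h2 := hr hsr
      have h3 := hC s hs
      rw [hfG s hs.le, norm_mul] at h3
      nlinarith [norm_nonneg (G s)]
  · filter_upwards [hdecay y a ha, eventually_ge_atTop 0] with τ h1 h2
    have h3 := h1.trans (hfle _ (by simpa using h2))
    rwa [Real.le_log_iff_exp_le ((Real.exp_pos _).trans_le h3)]

end Blaschke

/-! ### Growth of polynomials in the closed right half-plane -/

lemma exists_norm_aeval_le (p : ℝ[X]) :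
    ∃ A : ℝ, 0 < A ∧ ∀ s : ℂ, ‖aeval s p‖ ≤ A * (1 + ‖s‖) ^ p.natDegree := by
  refine ⟨∑ i ∈ Finset.range (p.natDegree + 1), ‖p.coeff i‖ + 1, by positivity, fun s => ?_⟩
  have h1 : (1 : ℝ) ≤ 1 + ‖s‖ := by linarith [norm_nonneg s]
  rw [aeval_eq_sum_range]
  calc ‖∑ i ∈ Finset.range (p.natDegree + 1), p.coeff i • s ^ i‖
      ≤ ∑ i ∈ Finset.range (p.natDegree + 1), ‖p.coeff i‖ * (1 + ‖s‖) ^ p.natDegree := by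
        refine norm_sum_le_of_le _ fun i hi => ?_
        rw [norm_smul, norm_pow]
        gcongr
        calc ‖s‖ ^ i ≤ (1 + ‖s‖) ^ i := by gcongr; linarith
          _ ≤ (1 + ‖s‖) ^ p.natDegree :=
            pow_le_pow_right₀ h1 (Nat.lt_succ_iff.1 (Finset.mem_range.1 hi))
    _ ≤ _ := by
        rw [← Finset.sum_mul]
        gcongr
        linarith

lemma exists_le_norm_sub_root {z : ℂ} (hz : z.re < 0) :
    ∃ c : ℝ, 0 < c ∧ ∀ s : ℂ, 0 ≤ s.re → c * (1 + ‖s‖) ≤ ‖s - z‖ := by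
  have hz' : 0 < -z.re := neg_pos.2 hz
  refine ⟨((1 + ‖z‖) / -z.re + 1)⁻¹, by positivity, fun s hs => ?_⟩
  have h1 : -z.re ≤ ‖s - z‖ := by
    have := Complex.re_le_norm (s - z)
    rw [Complex.sub_re] at this
    linarith
  have h2 : ‖s‖ ≤ ‖s - z‖ + ‖z‖ := by simpa using norm_add_le (s - z) z
  rw [inv_mul_le_iff₀ (by positivity), add_mul, one_mul]
  have h3 : 1 + ‖z‖ ≤ (1 + ‖z‖) / -z.re * ‖s - z‖ := by
    rw [div_mul_eq_mul_div, le_div_iff₀ hz']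
    gcongr
  linarith

/-- A polynomial without zeros in the closed right half-plane grows there at full rate. -/
lemma exists_le_norm_aeval {q : ℝ[X]} (hq : ∀ z : ℂ, aeval z q = 0 → z.re < 0) :
    ∃ c : ℝ, 0 < c ∧ ∀ s : ℂ, 0 ≤ s.re → c * (1 + ‖s‖) ^ q.natDegree ≤ ‖aeval s q‖ := by
  have hq0 : q ≠ 0 := by
    rintro rfl
    simpa using hq 0 (by simp)
  set Q : ℂ[X] := q.map (algebraMap ℝ ℂ) with hQ
  have hQ0 : Q ≠ 0 := by simpa [hQ] using hq0
  have hroots : ∀ M : Multiset ℂ, (∀ z ∈ M, z.re < 0) → ∃ c : ℝ, 0 < c ∧ ∀ s : ℂ, 0 ≤ s.re →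
      c * (1 + ‖s‖) ^ Multiset.card M ≤ ‖(M.map fun z => s - z).prod‖ := by
    intro M
    induction M using Multiset.induction_on with
    | empty => exact fun _ => ⟨1, one_pos, by simp⟩
    | cons z M ih =>
      intro h
      obtain ⟨c, hc, h1⟩ := ih fun w hw => h w (Multiset.mem_cons_of_mem hw)
      obtain ⟨d, hd, h2⟩ := exists_le_norm_sub_root (h z (Multiset.mem_cons_self _ _))
      refine ⟨d * c, by positivity, fun s hs => ?_⟩
      rw [Multiset.card_cons, Multiset.map_cons, Multiset.prod_cons, norm_mul, pow_succ]
      calc d * c * ((1 + ‖s‖) ^ Multiset.card M * (1 + ‖s‖))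
          = d * (1 + ‖s‖) * (c * (1 + ‖s‖) ^ Multiset.card M) := by ring
        _ ≤ _ := mul_le_mul (h2 s hs) (h1 s hs) (by positivity) (norm_nonneg _)
  obtain ⟨c, hc, h⟩ := hroots Q.roots fun z hz => hq z (by
    rw [← eval_map_algebraMap]; exact (mem_roots hQ0).1 hz)
  have hlead : 0 < ‖Q.leadingCoeff‖ := norm_pos_iff.2 (leadingCoeff_ne_zero.2 hQ0)
  refine ⟨‖Q.leadingCoeff‖ * c, by positivity, fun s hs => ?_⟩
  have hcard : Multiset.card Q.roots = q.natDegree := by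
    rw [← (IsAlgClosed.splits Q).natDegree_eq_card_roots, hQ, natDegree_map]
  have := h s hs
  rw [hcard] at this
  rw [← eval_map_algebraMap, (IsAlgClosed.splits Q).eval_eq_prod_roots, norm_mul, mul_assoc]
  gcongr

lemma exists_le_norm_aeval_horizontal {p : ℝ[X]} (hp : p ≠ 0) (y : ℝ) :
    ∃ c : ℝ, 0 < c ∧ ∀ᶠ τ : ℝ in atTop, c ≤ ‖aeval (τ + y * Complex.I : ℂ) p‖ := by
  set P : ℂ[X] := p.map (algebraMap ℝ ℂ) with hP
  have hP0 : P ≠ 0 := by simpa [hP] using hp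
  have hev : ∀ s : ℂ, aeval s p = P.eval s := fun s => (eval_map_algebraMap _ _).symm
  simp only [hev]
  rcases Nat.eq_zero_or_pos P.natDegree with h | h
  · rw [eq_C_of_natDegree_eq_zero h] at hP0 ⊢
    simp only [eval_C]
    refine ⟨‖P.coeff 0‖, norm_pos_iff.2 fun h0 => hP0 (by simp [h0]), .of_forall fun _ => le_rfl⟩
  · refine ⟨1, one_pos, (P.tendsto_norm_atTop (natDegree_pos_iff_degree_pos.1 h)
      (z := fun τ : ℝ => (τ + y * Complex.I : ℂ)) ?_).eventually_ge_atTop 1⟩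
    refine tendsto_atTop_mono (fun τ => ?_) tendsto_id
    simpa using Complex.re_le_norm (τ + y * Complex.I : ℂ)

lemma tendsto_add_pow_mul_exp_neg (m : ℝ) (d : ℕ) {b : ℝ} (hb : 0 < b) :
    Tendsto (fun τ : ℝ => (m + τ) ^ d * Real.exp (-(b * τ))) atTop (𝓝 0) := by
  have h := ((isLittleO_pow_exp_pos_mul_atTop d hb).tendsto_div_nhds_zero.comp
    (tendsto_atTop_add_const_left _ m tendsto_id)).mul_const (Real.exp (b * m))
  rw [zero_mul] at h
  refine h.congr fun τ => ?_
  simp only [Function.comp_apply, id]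
  rw [div_mul_eq_mul_div, mul_div_assoc, ← Real.exp_sub]
  congr 2
  ring

/-! ### Time-delay systems in the closed right half-plane -/

namespace DelaySystem

variable (R : DelaySystem)

lemma aeval_den_ne_zero {s : ℂ} (hs : 0 ≤ s.re) : aeval s R.den ≠ 0 := fun h =>
  absurd (R.stable s h) (not_lt.2 hs)

lemma analyticOnNhd_tf : AnalyticOnNhd ℂ R.tf {s | 0 ≤ s.re} := by
  intro s hs
  unfold tf
  exact Finset.analyticAt_fun_sum _ fun i _ =>
    ((analyticAt_id.aeval_polynomial _).div (analyticAt_id.aeval_polynomial _)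
      (R.aeval_den_ne_zero hs)).mul (analyticAt_const.mul analyticAt_id).cexp

lemma analyticOnNhd_advanced : AnalyticOnNhd ℂ R.advanced {s | 0 ≤ s.re} := fun s hs =>
  ((analyticAt_const.mul analyticAt_id).cexp).mul (R.analyticOnNhd_tf s hs)

lemma advanced_eq_sum (s : ℂ) : R.advanced s =
    ∑ i, aeval s (R.num i) / aeval s R.den *
      Complex.exp (-(R.delay i - R.delay 0 : ℝ) * s) := by
  rw [advanced, tf, Finset.mul_sum]
  refine Finset.sum_congr rfl fun i _ => ?_
  rw [mul_left_comm, ← Complex.exp_add, firstDelay]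
  congr 2
  push_cast
  ring

lemma norm_exp_delay (i : Fin (R.n + 1)) (s : ℂ) :
    ‖Complex.exp (-(R.delay i - R.delay 0 : ℝ) * s)‖ =
      Real.exp (-((R.delay i - R.delay 0) * s.re)) := by
  rw [Complex.norm_exp]
  congr 1
  simp
  ring

lemma advanced_eq_zero_iff (s : ℂ) : R.advanced s = 0 ↔ R.tf s = 0 := by
  simp [advanced, Complex.exp_ne_zero]

lemma exists_norm_coeff_le (i : Fin (R.n + 1)) :
    ∃ C : ℝ, ∀ s : ℂ, 0 ≤ s.re → ‖aeval s (R.num i) / aeval s R.den‖ ≤ C := by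
  obtain ⟨A, hA, h1⟩ := exists_norm_aeval_le (R.num i)
  obtain ⟨c, hc, h2⟩ := exists_le_norm_aeval R.stable
  refine ⟨A / c, fun s hs => ?_⟩
  have hx : (1 : ℝ) ≤ 1 + ‖s‖ := by linarith [norm_nonneg s]
  rw [norm_div, div_le_div_iff₀ (norm_pos_iff.2 (R.aeval_den_ne_zero hs)) hc]
  calc ‖aeval s (R.num i)‖ * c ≤ A * (1 + ‖s‖) ^ (R.num i).natDegree * c := by gcongr; exact h1 s
    _ ≤ A * (1 + ‖s‖) ^ R.den.natDegree * c := by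
      gcongr
      exact R.proper i
    _ = A * (c * (1 + ‖s‖) ^ R.den.natDegree) := by ring
    _ ≤ A * ‖aeval s R.den‖ := by gcongr; exact h2 s hs

lemma exists_norm_advanced_le : ∃ C : ℝ, ∀ s : ℂ, 0 < s.re → ‖R.advanced s‖ ≤ C := by
  choose C hC using R.exists_norm_coeff_le
  refine ⟨∑ i, C i, fun s hs => ?_⟩
  rw [advanced_eq_sum]
  refine norm_sum_le_of_le _ fun i _ => ?_
  rw [norm_mul, norm_exp_delay]
  refine (mul_le_of_le_one_right (norm_nonneg _) ?_).trans (hC i s hs.le)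
  rw [Real.exp_le_one_iff, neg_nonpos]
  exact mul_nonneg (sub_nonneg.2 (R.delay_strictMono.monotone (Fin.zero_le i))) hs.le

/-- Along a horizontal ray the term with the smallest delay dominates, and it decays at most
polynomially. -/
lemma exp_neg_le_norm_advanced (y a : ℝ) (ha : 0 < a) :
    ∀ᶠ τ : ℝ in atTop, Real.exp (-(a * τ)) ≤ ‖R.advanced (τ + y * Complex.I)‖ := by
  choose C hC using R.exists_norm_coeff_le
  obtain ⟨A, hA, hden⟩ := exists_norm_aeval_le R.den
  obtain ⟨c, hc, hnum⟩ := exists_le_norm_aeval_horizontal (R.num_ne_zero 0) y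
  set d := R.den.natDegree with hd
  have htail : Tendsto (fun τ : ℝ => ∑ i : Fin R.n, C i.succ *
      ((1 + |y| + τ) ^ d * Real.exp (-((R.delay i.succ - R.delay 0) * τ)))) atTop (𝓝 0) := by
    have := tendsto_finsetSum (Finset.univ : Finset (Fin R.n)) fun i _ =>
      (tendsto_add_pow_mul_exp_neg (1 + |y|) d
        (sub_pos.2 (R.delay_strictMono (Fin.succ_pos i)))).const_mul (C i.succ)
    simpa using this
  have hcA : 0 < c / (2 * A) := by positivity
  filter_upwards [hnum, htail.eventually (gt_mem_nhds hcA),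
    (tendsto_add_pow_mul_exp_neg (1 + |y|) d ha).eventually (gt_mem_nhds hcA),
    eventually_ge_atTop 0] with τ h1 h2 h3 hτ
  set s : ℂ := τ + y * Complex.I with hs
  have hsre : s.re = τ := by simp [hs]
  have hsre0 : 0 ≤ s.re := hsre ▸ hτ
  set q : ℝ := (1 + |y| + τ) ^ d with hq
  have hqpos : 0 < q := by positivity
  have hsn : 1 + ‖s‖ ≤ 1 + |y| + τ := by
    have : ‖s‖ ≤ |τ| + |y| := by
      refine (norm_add_le _ _).trans ?_
      simp
    rw [abs_of_nonneg hτ] at this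
    linarith
  have hden' : ‖aeval s R.den‖ ≤ A * q := (hden s).trans (by rw [hq]; gcongr)
  have hdenpos := norm_pos_iff.2 (R.aeval_den_ne_zero hsre0)
  have hfirst : c / A ≤ q * ‖aeval s (R.num 0) / aeval s R.den‖ := by
    rw [norm_div, mul_div_assoc', div_le_div_iff₀ hA hdenpos]
    calc c * ‖aeval s R.den‖ ≤ ‖aeval s (R.num 0)‖ * (A * q) :=
          mul_le_mul h1 hden' (norm_nonneg _) (norm_nonneg _)
      _ = _ := by ring
  have hsum : R.advanced s = aeval s (R.num 0) / aeval s R.den +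
      ∑ i : Fin R.n, aeval s (R.num i.succ) / aeval s R.den *
        Complex.exp (-(R.delay i.succ - R.delay 0 : ℝ) * s) := by
    rw [advanced_eq_sum, Fin.sum_univ_succ]
    simp
  have hrest : q * ‖∑ i : Fin R.n, aeval s (R.num i.succ) / aeval s R.den *
        Complex.exp (-(R.delay i.succ - R.delay 0 : ℝ) * s)‖ ≤ c / (2 * A) := by
    refine le_trans ?_ h2.le
    refine (mul_le_mul_of_nonneg_left (norm_sum_le _ _) hqpos.le).trans ?_
    rw [Finset.mul_sum]
    refine Finset.sum_le_sum fun i _ => ?_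
    rw [norm_mul, norm_exp_delay, hsre, mul_left_comm]
    gcongr
    exact hC i.succ s hsre0
  have hge : c / (2 * A) ≤ q * ‖R.advanced s‖ := by
    have h4 : ‖aeval s (R.num 0) / aeval s R.den‖ ≤ ‖R.advanced s‖ +
        ‖∑ i : Fin R.n, aeval s (R.num i.succ) / aeval s R.den *
          Complex.exp (-(R.delay i.succ - R.delay 0 : ℝ) * s)‖ := by
      rw [hsum]
      simpa using norm_sub_le (aeval s (R.num 0) / aeval s R.den +
        ∑ i : Fin R.n, aeval s (R.num i.succ) / aeval s R.den *
          Complex.exp (-(R.delay i.succ - R.delay 0 : ℝ) * s))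
        (∑ i : Fin R.n, aeval s (R.num i.succ) / aeval s R.den *
          Complex.exp (-(R.delay i.succ - R.delay 0 : ℝ) * s))
    have h5 := mul_le_mul_of_nonneg_left h4 hqpos.le
    have h6 : c / A = c / (2 * A) + c / (2 * A) := by field_simp; ring
    rw [mul_add] at h5
    linarith
  exact le_of_mul_le_mul_left (h3.le.trans hge) hqpos

lemma exists_tf_ne_zero : ∃ s : ℂ, 0 ≤ s.re ∧ R.tf s ≠ 0 := by
  obtain ⟨τ, h1, h2⟩ :=
    ((R.exp_neg_le_norm_advanced 0 1 one_pos).and (eventually_ge_atTop 0)).exists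
  refine ⟨τ + (0 : ℝ) * Complex.I, by simpa using h2, ?_⟩
  rw [Ne, ← advanced_eq_zero_iff]
  exact norm_pos_iff.1 ((Real.exp_pos _).trans_le h1)

/-! ### Conjugation symmetry and boundary values -/

lemma tf_conj (s : ℂ) : R.tf (conj s) = conj (R.tf s) := by
  rw [tf, tf, map_sum]
  refine Finset.sum_congr rfl fun i _ => ?_
  rw [map_mul, map_div₀, aeval_conj, aeval_conj, ← Complex.exp_conj]
  simp

lemma analyticOrderAt_tf_conj {z : ℂ} (hz : 0 < z.re) :
    analyticOrderAt R.tf (conj z) = analyticOrderAt R.tf z := by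
  have hfin : analyticOrderAt R.tf z ≠ ⊤ := by
    rw [Ne, analyticOrderAt_eq_top]
    exact not_eventually_eq_zero R.analyticOnNhd_tf R.exists_tf_ne_zero hz.le
  obtain ⟨k, hk⟩ := ENat.ne_top_iff_exists.1 hfin
  rw [← hk]
  have hz' : 0 ≤ (conj z).re := by simpa using hz.le
  obtain ⟨h, hh, hh0, heq⟩ := (R.analyticOnNhd_tf z hz.le).analyticOrderAt_eq_natCast.1 hk.symm
  have hcont : Tendsto (fun s : ℂ => conj s) (𝓝 (conj z)) (𝓝 z) :=
    Continuous.tendsto' Complex.continuous_conj _ _ (Complex.conj_conj z)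
  refine (R.analyticOnNhd_tf _ hz').analyticOrderAt_eq_natCast.2
    ⟨fun s => conj (h (conj s)), ?_, by simpa using hh0, ?_⟩
  · rw [Complex.analyticAt_iff_eventually_differentiableAt] at hh ⊢
    filter_upwards [hcont.eventually hh] with s hs
    simpa [Function.comp_def] using hs.conj_conj
  · filter_upwards [hcont.eventually heq] with s hs
    rw [← Complex.conj_conj (R.tf s), ← tf_conj, hs]
    simp

lemma norm_advanced_mul_I (ω : ℝ) :
    ‖R.advanced (ω * Complex.I)‖ = ‖R.tf (ω * Complex.I)‖ := by
  rw [advanced, norm_mul, Complex.norm_exp]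
  simp

/-- The conjugate system has the same modulus on the imaginary axis. -/
lemma norm_conjugate_tf_mul_I (ω : ℝ) :
    ‖R.conjugate.tf (ω * Complex.I)‖ = ‖R.tf (ω * Complex.I)‖ := by
  have hc : -(ω * Complex.I : ℂ) = conj (ω * Complex.I : ℂ) := by simp
  have h0 : ∀ x : ℝ, aeval (x * Complex.I : ℂ) R.den ≠ 0 := fun x =>
    R.aeval_den_ne_zero (by simp)
  rw [conjugate_tf _ _ (by simpa using h0 (-ω)), allPass, hc, tf_conj, aeval_conj, norm_mul,
    norm_mul, norm_div, Complex.norm_conj, Complex.norm_conj,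
    div_self (norm_ne_zero_iff.2 (h0 ω)), Complex.norm_exp]
  simp

lemma conjugate_firstDelay : R.conjugate.firstDelay = 0 := by
  change R.lastDelay - R.delay (Fin.rev 0) = 0
  rw [Fin.rev_zero, lastDelay, sub_self]

lemma conjugate_advanced : R.conjugate.advanced = R.conjugate.tf := by
  ext s
  rw [advanced, conjugate_firstDelay]
  simp

/-! ### The inner-outer factorization of an `F`-system -/

/-- The unstable zeros of an `F`-system, as a `Finset`. -/
noncomputable def IsFSystem.zeros {R : DelaySystem} (hR : R.IsFSystem) : Finset ℂ :=
  Set.Finite.toFinset (s := unstableZeros R.tf) hR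

lemma IsFSystem.mem_zeros {R : DelaySystem} (hR : R.IsFSystem) {s : ℂ} :
    s ∈ hR.zeros ↔ 0 < s.re ∧ R.tf s = 0 :=
  Set.Finite.mem_toFinset (s := unstableZeros R.tf) hR

lemma innerPart_eq_blaschkeProduct (hR : R.IsFSystem) :
    R.innerPart = blaschkeProduct hR.zeros (analyticOrderNatAt R.tf) := by
  ext s
  exact finprod_mem_eq_finite_toFinset_prod _ hR

variable {R}

lemma re_pos_of_mem_zeros (hR : R.IsFSystem) : ∀ z ∈ hR.zeros, 0 < z.re := fun _ hz =>
  (hR.mem_zeros.1 hz).1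

lemma isInner_innerPart (hR : R.IsFSystem) : IsInner R.innerPart := by
  rw [innerPart_eq_blaschkeProduct R hR]
  exact isInner_blaschkeProduct (re_pos_of_mem_zeros hR)

lemma isFiniteDimensional_innerPart (hR : R.IsFSystem) : IsFiniteDimensional R.innerPart := by
  rw [innerPart_eq_blaschkeProduct R hR]
  refine isFiniteDimensional_blaschkeProduct (re_pos_of_mem_zeros hR) (fun z hz => ?_)
    fun z hz => ?_
  · rw [hR.mem_zeros] at hz ⊢
    exact ⟨by simpa using hz.1, by rw [tf_conj, hz.2, map_zero]⟩
  · rw [analyticOrderNatAt, analyticOrderNatAt,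
      analyticOrderAt_tf_conj R (re_pos_of_mem_zeros hR z hz)]

lemma innerPart_ne_zero (hR : R.IsFSystem) {s : ℂ} (hs : 0 < s.re) (h : R.tf s ≠ 0) :
    R.innerPart s ≠ 0 := by
  rw [innerPart_eq_blaschkeProduct R hR]
  refine blaschkeProduct_ne_zero (re_pos_of_mem_zeros hR) hs.le fun hmem => h ?_
  exact (hR.mem_zeros.1 hmem).2

/-- An `F`-system without its input delay is its inner part times an outer function, which has the
modulus of the system on the imaginary axis. -/
theorem exists_isRegularOuter_eq_innerPart_mul (hR : R.IsFSystem) :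
    ∃ g : ℂ → ℂ, IsRegularOuter g ∧
      (∀ s : ℂ, 0 ≤ s.re → R.advanced s = R.innerPart s * g s) ∧
      ∀ ω : ℝ, ‖g (ω * Complex.I)‖ = ‖R.tf (ω * Complex.I)‖ := by
  obtain ⟨g, hg, hfg⟩ := exists_isRegularOuter_eq_blaschkeProduct_mul
    R.analyticOnNhd_advanced R.exists_norm_advanced_le R.exp_neg_le_norm_advanced
    (Z := hR.zeros) fun s => by
      rw [hR.mem_zeros, advanced_eq_zero_iff]
  have hord : ∀ z ∈ hR.zeros, analyticOrderNatAt R.advanced z = analyticOrderNatAt R.tf z := by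
    intro z hz
    have he : AnalyticAt ℂ (fun s => Complex.exp ((R.firstDelay : ℂ) * s)) z :=
      (analyticAt_const.mul analyticAt_id).cexp
    have h1 : analyticOrderAt R.advanced z = 0 + analyticOrderAt R.tf z := by
      rw [← he.analyticOrderAt_eq_zero.2 (Complex.exp_ne_zero _), ← analyticOrderAt_mul he
        (R.analyticOnNhd_tf z (re_pos_of_mem_zeros hR z hz).le)]
      rfl
    rw [analyticOrderNatAt, analyticOrderNatAt, h1, zero_add]
  have hB : ∀ s, blaschkeProduct hR.zeros (analyticOrderNatAt R.advanced) s =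
      R.innerPart s := by
    intro s
    rw [innerPart_eq_blaschkeProduct R hR]
    exact Finset.prod_congr rfl fun z hz => by rw [hord z hz]
  simp only [hB] at hfg
  refine ⟨g, hg, hfg, fun ω => ?_⟩
  rw [← norm_advanced_mul_I, hfg _ (by simp), norm_mul, innerPart_eq_blaschkeProduct R hR,
    norm_blaschkeProduct_mul_I (re_pos_of_mem_zeros hR), one_mul]

end DelaySystem

/-! ### Zeros, poles and factorizations of plants -/

lemma IsRegularOuter.isOuterFactor_div {R T : DelaySystem} {g₁ g₂ : ℂ → ℂ}
    (h₁ : IsRegularOuter g₁) (h₂ : IsRegularOuter g₂)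
    (e₁ : ∀ ω : ℝ, ‖g₁ (ω * Complex.I)‖ = ‖R.tf (ω * Complex.I)‖)
    (e₂ : ∀ ω : ℝ, ‖g₂ (ω * Complex.I)‖ = ‖T.tf (ω * Complex.I)‖) :
    IsOuterFactor R T fun s => g₁ s / g₂ s := by
  refine ⟨h₁.isOuter_div h₂, fun ⟨C, hC⟩ => h₁.bounded_div h₂ (C := C) (.of_forall fun ω => ?_)⟩
  rw [norm_div, e₁, e₂, ← norm_div]
  exact hC ω

lemma finite_plantUnstablePoles {R T : DelaySystem} (hT : T.IsFSystem) :
    (plantUnstablePoles R T).Finite := by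
  refine Set.Finite.subset hT fun s hs => ⟨hs.1, ?_⟩
  by_contra h
  exact not_lt.2 ((R.analyticOnNhd_tf s hs.1.le).div (T.analyticOnNhd_tf s hs.1.le)
    h).meromorphicOrderAt_nonneg hs.2

lemma finite_plantUnstableZeros {R T : DelaySystem} (hR : R.IsFSystem) :
    (plantUnstableZeros R T).Finite := by
  refine Set.Finite.subset hR fun s hs => ⟨hs.1, ?_⟩
  by_contra h
  have hRa := R.analyticOnNhd_tf s hs.1.le
  have hTa := T.analyticOnNhd_tf s hs.1.le
  have hT0 := (hTa.eventually_eq_zero_or_eventually_ne_zero).resolve_left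
    (not_eventually_eq_zero T.analyticOnNhd_tf T.exists_tf_ne_zero hs.1.le)
  -- `R = P T` near `s`, so the order of `R` at `s` is at least that of `P`
  have hmul : meromorphicOrderAt R.tf s =
      meromorphicOrderAt (plant R T) s + meromorphicOrderAt T.tf s := by
    rw [← meromorphicOrderAt_mul (f := plant R T) (hRa.meromorphicAt.div hTa.meromorphicAt)
      hTa.meromorphicAt]
    refine meromorphicOrderAt_congr ?_
    filter_upwards [hT0] with t ht
    rw [Pi.mul_apply, plant, div_mul_cancel₀ _ ht]
  have hR0 : meromorphicOrderAt R.tf s = 0 := by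
    rw [hRa.meromorphicOrderAt_eq, hRa.analyticOrderAt_eq_zero.2 h]
    rfl
  rw [hR0] at hmul
  exact absurd hmul (ne_of_lt (add_pos_of_pos_of_nonneg hs.2 hTa.meromorphicOrderAt_nonneg))

theorem exp_sub_mul_advanced_div (R T : DelaySystem) (s : ℂ) :
    Complex.exp (-((R.firstDelay - T.firstDelay : ℝ) : ℂ) * s) * R.advanced s / T.advanced s =
      plant R T s := by
  rw [DelaySystem.advanced, DelaySystem.advanced, ← mul_assoc, ← Complex.exp_add, plant]
  rw [show -((R.firstDelay - T.firstDelay : ℝ) : ℂ) * s + (R.firstDelay : ℂ) * s =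
    (T.firstDelay : ℂ) * s by push_cast; ring]
  exact mul_div_mul_left _ _ (Complex.exp_ne_zero _)

/-- The factorization of a plant whose denominator `T` is an `F`-system with outer part `gT`, from a
factorization `m g` of the numerator, advanced by the input delay of `T`, into an inner function `m`
and a regular outer function `g` with the modulus of `R` on the imaginary axis. -/
lemma IsRegularOuter.isFactorizationOne {R T : DelaySystem} (hT : T.IsFSystem) {m g gT : ℂ → ℂ}
    (hm : IsInner m) (hg : IsRegularOuter g)
    (eg : ∀ ω : ℝ, ‖g (ω * Complex.I)‖ = ‖R.tf (ω * Complex.I)‖) (hgT : IsRegularOuter gT)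
    (egT : ∀ ω : ℝ, ‖gT (ω * Complex.I)‖ = ‖T.tf (ω * Complex.I)‖)
    (hfT : ∀ s : ℂ, 0 ≤ s.re → T.advanced s = T.innerPart s * gT s)
    (hmg : ∀ s : ℂ, 0 < s.re → m s * g s =
      Complex.exp (-((R.firstDelay - T.firstDelay : ℝ) : ℂ) * s) * R.advanced s) :
    IsFactorizationOne R T m T.innerPart fun s => g s / gT s where
  inner_mn := hm
  inner_md := DelaySystem.isInner_innerPart hT
  finite_md := DelaySystem.isFiniteDimensional_innerPart hT
  outer_No := hg.isOuterFactor_div hgT eg egT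
  eq s hs hTs := by
    refine ⟨DelaySystem.innerPart_ne_zero hT hs hTs, ?_⟩
    rw [← exp_sub_mul_advanced_div, ← hmg s hs, hfT s hs.le, mul_div_assoc', div_div,
      mul_comm (gT s)]

theorem corollary4 (R T : DelaySystem) :
    -- IF plants
    (R.IsISystem → T.IsFSystem →
      (plantUnstablePoles R T).Finite ∧
      (T.firstDelay ≤ R.firstDelay → ∃ mn No : ℂ → ℂ,
        IsFactorizationOne R T mn T.innerPart No ∧
        (∀ s : ℂ, 0 < s.re → R.conjugate.tf s ≠ 0 →
          mn s = Complex.exp (-((R.firstDelay - T.firstDelay : ℝ) : ℂ) * s) *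
            R.conjugate.innerPart s * (R.advanced s / R.conjugate.tf s)) ∧
        (∀ s : ℂ, 0 < s.re → R.conjugate.tf s ≠ 0 → T.tf s ≠ 0 →
          No s = R.conjugate.tf s / R.conjugate.innerPart s *
            (T.innerPart s / T.advanced s)))) ∧
    -- FI plants
    (R.IsFSystem → T.IsISystem →
      (plantUnstableZeros R T).Finite ∧
      (R.firstDelay = T.firstDelay → ∃ mn No : ℂ → ℂ,
        IsFactorizationTwo R T mn R.innerPart No ∧
        (∀ s : ℂ, 0 < s.re → T.conjugate.tf s ≠ 0 →
          mn s = T.conjugate.innerPart s * (T.advanced s / T.conjugate.tf s)) ∧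
        (∀ s : ℂ, 0 < s.re → R.tf s ≠ 0 → T.conjugate.tf s ≠ 0 →
          No s = R.advanced s / R.innerPart s *
            (T.conjugate.innerPart s / T.conjugate.tf s)))) ∧
    -- FF plants
    (R.IsFSystem → T.IsFSystem →
      (plantUnstableZeros R T).Finite ∧ (plantUnstablePoles R T).Finite ∧
      (T.firstDelay ≤ R.firstDelay → ∃ mn No : ℂ → ℂ,
        IsFactorizationOne R T mn T.innerPart No ∧
        (∀ s : ℂ, 0 < s.re →
          mn s = Complex.exp (-((R.firstDelay - T.firstDelay : ℝ) : ℂ) * s) *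
            R.innerPart s) ∧
        (R.firstDelay = T.firstDelay → IsFiniteDimensional mn) ∧
        (∀ s : ℂ, 0 < s.re → R.tf s ≠ 0 → T.tf s ≠ 0 →
          No s = R.advanced s / R.innerPart s * (T.innerPart s / T.advanced s)))) := by
  refine ⟨fun hR hT => ⟨finite_plantUnstablePoles hT, fun hle => ?_⟩,
    fun hR hT => ⟨finite_plantUnstableZeros hR, fun heq => ?_⟩,
    fun hR hT => ⟨finite_plantUnstableZeros hR, finite_plantUnstablePoles hT, fun hle => ?_⟩⟩
  · obtain ⟨g, hg, hfg, eg⟩ := DelaySystem.exists_isRegularOuter_eq_innerPart_mul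
      (R := R.conjugate) hR
    obtain ⟨gT, hgT, hfT, egT⟩ := DelaySystem.exists_isRegularOuter_eq_innerPart_mul hT
    simp only [DelaySystem.conjugate_advanced, DelaySystem.norm_conjugate_tf_mul_I] at hfg eg
    have hm : IsInner fun s => R.advanced s / g s :=
      hg.isInner_div R.analyticOnNhd_advanced R.exists_norm_advanced_le fun ω => by
        rw [R.norm_advanced_mul_I, eg]
    refine ⟨_, _, hg.isFactorizationOne hT ((isInner_exp (sub_nonneg.2 hle)).mul hm) eg hgT egT hfT
      fun s hs => ?_, fun s hs h0 => ?_, fun s hs h0 hT0 => ?_⟩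
    · rw [mul_assoc, div_mul_cancel₀ _ (hg.ne_zero s hs)]
    · rw [hfg s hs.le] at h0 ⊢
      have := left_ne_zero_of_mul h0
      have := hg.ne_zero s hs
      field_simp
    · rw [hfg s hs.le] at h0 ⊢
      rw [hfT s hs.le]
      have := left_ne_zero_of_mul h0
      have := DelaySystem.innerPart_ne_zero hT hs hT0
      have := hgT.ne_zero s hs
      field_simp
  · obtain ⟨gR, hgR, hfR, eR⟩ := DelaySystem.exists_isRegularOuter_eq_innerPart_mul hR
    obtain ⟨g, hg, hfg, eg⟩ := DelaySystem.exists_isRegularOuter_eq_innerPart_mul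
      (R := T.conjugate) hT
    simp only [DelaySystem.conjugate_advanced, DelaySystem.norm_conjugate_tf_mul_I] at hfg eg
    have hm : IsInner fun s => T.advanced s / g s :=
      hg.isInner_div T.analyticOnNhd_advanced T.exists_norm_advanced_le fun ω => by
        rw [T.norm_advanced_mul_I, eg]
    refine ⟨_, fun s => gR s / g s, ⟨hm, DelaySystem.isInner_innerPart hR,
      DelaySystem.isFiniteDimensional_innerPart hR, hgR.isOuterFactor_div hg eR eg,
      fun s hs hTs => ?_⟩, fun s hs h0 => ?_, fun s hs hR0 h0 => ?_⟩
    · have hTa : T.advanced s ≠ 0 := (T.advanced_eq_zero_iff s).not.2 hTs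
      have hg0 := hg.ne_zero s hs
      refine ⟨div_ne_zero hTa hg0, ?_⟩
      rw [← exp_sub_mul_advanced_div, heq, sub_self, hfR s hs.le]
      simp only [Complex.ofReal_zero, neg_zero, zero_mul, Complex.exp_zero, one_mul]
      field_simp
    · rw [hfg s hs.le] at h0 ⊢
      have := left_ne_zero_of_mul h0
      have := hg.ne_zero s hs
      field_simp
    · rw [hfg s hs.le] at h0 ⊢
      rw [hfR s hs.le]
      have := left_ne_zero_of_mul h0
      have := DelaySystem.innerPart_ne_zero hR hs hR0
      have := hg.ne_zero s hs
      field_simp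
  · obtain ⟨gR, hgR, hfR, eR⟩ := DelaySystem.exists_isRegularOuter_eq_innerPart_mul hR
    obtain ⟨gT, hgT, hfT, eT⟩ := DelaySystem.exists_isRegularOuter_eq_innerPart_mul hT
    refine ⟨_, _, hgR.isFactorizationOne hT ((isInner_exp (sub_nonneg.2 hle)).mul
      (DelaySystem.isInner_innerPart hR)) eR hgT eT hfT fun s hs => ?_, fun s _ => rfl,
      fun heq => ?_, fun s hs hR0 hT0 => ?_⟩
    · rw [hfR s hs.le, mul_assoc]
    · simpa [heq] using DelaySystem.isFiniteDimensional_innerPart hR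
    · rw [hfR s hs.le, hfT s hs.le]
      have := DelaySystem.innerPart_ne_zero hR hs hR0
      have := DelaySystem.innerPart_ne_zero hT hs hT0
      have := hgT.ne_zero s hs
      field_simp
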